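/- Let $\mathbb{L}^2$ be the square lattice: its vertex set is $\mathbb{Z}^2$, and two vertices are adjacent when their $\ell^1$-distance is $1$. Let $\varepsilon\in[0,1]$ satisfy $(1-2\varepsilon)^2\le \tfrac12$. Let $X=(X_u)_{u\in\mathbb{Z}^2}$ be i.i.d. uniform spins in $\{-1,+1\}$. Given $X$, let the edge observations $Y=(Y_e)_{e\in E(\mathbb{L}^2)}$ be independent, where for $e=\{u,w\}$ the variable $Y_e$ is the output of the binary symmetric channel $\mathsf{BSC}_\varepsilon$ with input $X_uX_w$; that is, $Y_e=X_uX_w$ with probability $1-\varepsilon$ and $Y_e=-X_uX_w$ with probability $\varepsilon$. For a pair $(A,B)$ with joint law $\nu_{A,B}$ and marginals $\nu_A,\nu_B$, the chi-squared mutual information is $I_2(A;B)=\int\left(\frac{d\nu_{A,B}}{d(\nu_A\times\nu_B)}-1\right)^2 d(\nu_A\times\nu_B)$, with the value $+\infty$ if $\nu_{A,B}\not\ll\nu_A\times\nu_B$. The conditional version $I_2(A;B\mid Y)$ is the average over $Y$ of the chi-squared mutual information of $(A,B)$ under its regular conditional law given $Y$. Let $v_1,v_2,\ldots$ be any sequence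 of vertices such that $v_k$ is at graph distance $k$ from $0$ in $\mathbb{L}^2$ for every $k\ge 1$. Then $$I_2(X_0;X_{v_k}\mid Y)\to 0\qquad\text{as } k\to\infty .$$ -/

import Mathlib

open MeasureTheory ProbabilityTheory Filter Topology
open scoped ENNReal

namespace GridSync

section Information

variable {Ω α β γ : Type*} [MeasurableSpace Ω] [MeasurableSpace α] [MeasurableSpace β]
  [MeasurableSpace γ]

open Classical in
/-- The chi-squared divergence `∫ (dμ/dν - 1)² dν`, set to `∞` when `μ` is not absolutely
continuous with respect to `ν`. -/
noncomputable def chiSqDiv (μ ν : Measure α) : ℝ≥0∞ :=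
  if μ ≪ ν then ∫⁻ x, ENNReal.ofReal (((μ.rnDeriv ν x).toReal - 1) ^ 2) ∂ν else ∞

/-- The chi-squared mutual information of the two coordinates under a joint law `ρ`: the
chi-squared divergence of `ρ` from the product of its marginals. -/
noncomputable def jointChiSqInfo (ρ : Measure (α × β)) : ℝ≥0∞ :=
  chiSqDiv ρ (ρ.fst.prod ρ.snd)

/-- The chi-squared mutual information `I₂(A; B)`. -/
noncomputable def chiSqInfo (A : Ω → α) (B : Ω → β) (P : Measure Ω) : ℝ≥0∞ :=
  jointChiSqInfo (P.map fun ω => (A ω, B ω))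

/-- The conditional chi-squared mutual information `I₂(A; B | Y)`: the average, over the law of
`Y`, of the chi-squared mutual information of `(A, B)` under its regular conditional law given
`Y = y`. -/
noncomputable def condChiSqInfo [StandardBorelSpace α] [Nonempty α] [StandardBorelSpace β]
    [Nonempty β] (A : Ω → α) (B : Ω → β) (Y : Ω → γ) (P : Measure Ω) [IsFiniteMeasure P] :
    ℝ≥0∞ :=
  ∫⁻ y, jointChiSqInfo (condDistrib (fun ω => (A ω, B ω)) Y P y) ∂(P.map Y)

end Information

section Synchronization

instance : DiscreteMeasurableSpace ℤˣ where
  forall_measurableSet s :=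
    ⟨Units.val '' s, MeasurableSet.of_discrete, Set.preimage_image_eq s Units.val_injective⟩

variable {V : Type*}

/-- The product `x_e = x_u * x_v` of the spins at the endpoints of the edge `e = {u, v}`. The
spins `-1, +1` are the elements of `ℤˣ`. -/
def edgeSpin (x : V → ℤˣ) : Sym2 V → ℤˣ :=
  Sym2.lift ⟨fun u v => x u * x v, fun u v => mul_comm (x u) (x v)⟩

lemma measurable_edgeSpin (e : Sym2 V) : Measurable fun x : V → ℤˣ => edgeSpin x e := by
  induction e with
  | h u v =>
    have h : Measurable fun p : ℤˣ × ℤˣ => p.1 * p.2 := measurable_of_countable _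
    have h' : Measurable fun x : V → ℤˣ => (x u, x v) :=
      (measurable_pi_apply u).prodMk (measurable_pi_apply v)
    exact h.comp h'

/-- The law of i.i.d. uniform spins indexed by `V`. -/
noncomputable def spinLaw (V : Type*) : Measure (V → ℤˣ) :=
  Measure.infinitePi fun _ : V => (PMF.uniformOfFintype ℤˣ).toMeasure

instance : IsProbabilityMeasure (spinLaw V) := by
  unfold spinLaw
  infer_instance

/-- The graphical channel `P_{G,Q}`: given the vertex spins `x`, the outputs on the edges are
independent, the output on `e` having law `Q e (x_e)`. -/
noncomputable def graphicalChannel (G : SimpleGraph V) {𝒴 : G.edgeSet → Type*}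
    [∀ e, MeasurableSpace (𝒴 e)] (Q : ∀ e, Kernel ℤˣ (𝒴 e)) [∀ e, IsMarkovKernel (Q e)] :
    Kernel (V → ℤˣ) (∀ e, 𝒴 e) where
  toFun x := Measure.infinitePi fun e => Q e (edgeSpin x e)
  measurable' := by
    refine Measurable.measure_of_isPiSystem_of_isProbabilityMeasure
      (generateFrom_squareCylinders (α := 𝒴)).symm
      (isPiSystem_squareCylinders (fun _ => MeasurableSpace.isPiSystem_measurableSet)
        (fun _ => MeasurableSet.univ)) ?_
    rintro _ ⟨s, t, ht, rfl⟩
    have ht' : ∀ e, MeasurableSet (t e) := fun e => ht e (Set.mem_univ e)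
    simp only [Measure.infinitePi_pi _ (fun e _ => ht' e)]
    exact Finset.measurable_fun_prod s fun e _ =>
      ((Q e).measurable_coe (ht' e)).comp (measurable_edgeSpin _)

instance (G : SimpleGraph V) {𝒴 : G.edgeSet → Type*} [∀ e, MeasurableSpace (𝒴 e)]
    (Q : ∀ e, Kernel ℤˣ (𝒴 e)) [∀ e, IsMarkovKernel (Q e)] :
    IsMarkovKernel (graphicalChannel G Q) where
  isProbabilityMeasure x :=
    inferInstanceAs (IsProbabilityMeasure (Measure.infinitePi fun e => Q e (edgeSpin x e)))

/-- `(X, Y)` is a binary synchronization instance drawn from `P_{G,Q}`: `X` consists of i.i.d.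
uniform spins and `Y` is the output of `X` through the channel `P_{G,Q}`. -/
def IsSyncInstance {Ω : Type*} [MeasurableSpace Ω] (P : Measure Ω) (G : SimpleGraph V)
    {𝒴 : G.edgeSet → Type*} [∀ e, MeasurableSpace (𝒴 e)] (Q : ∀ e, Kernel ℤˣ (𝒴 e))
    [∀ e, IsMarkovKernel (Q e)] (X : Ω → V → ℤˣ) (Y : Ω → ∀ e, 𝒴 e) : Prop :=
  HasLaw (fun ω => (X ω, Y ω)) (spinLaw V ⊗ₘ graphicalChannel G Q) P

/-- The binary symmetric channel: the output is the input with probability `1 - ε` and its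
negation with probability `ε`. -/
noncomputable def bsc (ε : unitInterval) : Kernel ℤˣ ℤˣ :=
  Kernel.ofFunOfCountable fun x =>
    ENNReal.ofReal (1 - ε) • Measure.dirac x + ENNReal.ofReal ε • Measure.dirac (-x)

instance (ε : unitInterval) : IsMarkovKernel (bsc ε) where
  isProbabilityMeasure x := by
    constructor
    change (ENNReal.ofReal (1 - ε) • Measure.dirac x +
      ENNReal.ofReal ε • Measure.dirac (-x) : Measure ℤˣ) Set.univ = 1
    simp only [Measure.add_apply, Measure.smul_apply, measure_univ, smul_eq_mul, mul_one]
    rw [← ENNReal.ofReal_add (sub_nonneg.2 ε.2.2) ε.2.1]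
    simp

end Synchronization

/-- The square lattice: the graph on `ℤ²` in which two vertices are adjacent when their
`ℓ¹`-distance is `1`. -/
def squareLattice : SimpleGraph (ℤ × ℤ) where
  Adj u v := |u.1 - v.1| + |u.2 - v.2| = 1
  symm := ⟨fun u v h => by rwa [abs_sub_comm v.1, abs_sub_comm v.2]⟩
  loopless := ⟨fun u h => by simp at h⟩

end GridSync

/-! A global spin flip does not change the law of the observations, so given `Y` each spin is still
uniform. For a pair of signs with uniform marginals the chi-squared information is the square of the
correlation (`jointChiSqInfo_eq`), and the quantity to bound is E[E[X_0 X_v | Y]²].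

For observations on a finite edge set this second moment is `infoSum`. A binary symmetric channel
with (1-2ε)² ≤ 1/2 is less informative, in this sense, than an erasure channel that reveals its
input exactly with probability 1/2 (`condSq_step`). Replacing the channels one by one leaves exact
observations on a uniformly random set of edges (`infoSum_le_avg`). If these edges do not join 0 to
v, flipping the spins on a separating set shows that they carry no information
(`infoSum_eq_zero_of_separated`); otherwise the information is at most 1. The bound is thus a
connection probability in fair bond percolation, uniformly in the finite edge set
(`exists_infoSum_le`), and martingale convergence passes to the whole of `Y`
(`integral_correlation_sq_le`).

It remains to show that in bond percolation at p = 1/2 connections from 0 to distance M have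
vanishing probability (`exists_pr_not_separated_le`). This is a Russo–Seymour–Welsh argument.
Self-duality blocks squares with probability at least 1/2 (`half_le_pr_blockH_square`); conditioning
on the cluster of a side and reflecting produces a hook (`eighth_le_pr_hook`); two hooks and a
square block a longer rectangle (`blockV_of_hook`); Harris' inequality glues rectangles into an
annulus (`le_pr_blockAnnulus`); disjoint annuli are independent.

Closed dual paths never appear explicitly. The absence of an open crossing is certified by a set of
vertices closed under open steps, whose boundary plays the role of the dual path. Gluing dual paths
becomes taking unions and intersections of such sets, and planarity enters only through the parity
argument of `inter_nonempty_of_linked`. -/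

namespace GridSync

/-! ### Fair percolation on local events: averages over finite cubes, independence, Harris'
inequality. -/

section FairPercolation

variable {ι κ : Type*}

/-- The average of `f` over all subsets of `F`. -/
noncomputable def avg (F : Finset ι) (f : Set ι → ℝ) : ℝ :=
  (∑ T ∈ F.powerset, f ↑T) / 2 ^ F.card

open Classical in
/-- The probability that a uniformly random subset of `F` satisfies `A`. -/
noncomputable def prob (F : Finset ι) (A : Set ι → Prop) : ℝ :=
  avg F fun T => if A T then 1 else 0

/-- The event `A` only depends on the elements of `E`. -/
def LocalOn (E : Set ι) (A : Set ι → Prop) : Prop :=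
  ∀ T T' : Set ι, T ∩ E = T' ∩ E → (A T ↔ A T')

lemma LocalOn.mono {E E' : Set ι} {A : Set ι → Prop} (h : LocalOn E A) (hE : E ⊆ E') :
    LocalOn E' A := fun T T' hT => h T T' (by
  have : T ∩ E' ∩ E = T' ∩ E' ∩ E := by rw [hT]
  rwa [Set.inter_assoc, Set.inter_assoc, Set.inter_eq_self_of_subset_right hE] at this)

lemma LocalOn.and {E : Set ι} {A B : Set ι → Prop} (hA : LocalOn E A) (hB : LocalOn E B) :
    LocalOn E fun T => A T ∧ B T := fun T T' h => and_congr (hA T T' h) (hB T T' h)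

lemma LocalOn.not {E : Set ι} {A : Set ι → Prop} (hA : LocalOn E A) :
    LocalOn E fun T => ¬ A T := fun T T' h => not_congr (hA T T' h)

lemma avg_mono {F : Finset ι} {f g : Set ι → ℝ} (h : ∀ T : Set ι, T ⊆ F → f T ≤ g T) :
    avg F f ≤ avg F g := by
  unfold avg
  gcongr with T hT
  exact h _ (by simpa using hT)

lemma avg_const (F : Finset ι) (c : ℝ) : avg F (fun _ => c) = c := by
  simp [avg, Finset.card_powerset]

lemma avg_congr {F : Finset ι} {f g : Set ι → ℝ} (h : ∀ T : Set ι, T ⊆ F → f T = g T) :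
    avg F f = avg F g :=
  le_antisymm (avg_mono fun T hT => (h T hT).le) (avg_mono fun T hT => (h T hT).ge)

lemma avg_mul_left (F : Finset ι) (c : ℝ) (f : Set ι → ℝ) :
    avg F (fun T => c * f T) = c * avg F f := by
  simp [avg, ← Finset.mul_sum, mul_div_assoc]

lemma avg_mul_right (F : Finset ι) (c : ℝ) (f : Set ι → ℝ) :
    avg F (fun T => f T * c) = avg F f * c := by
  simp only [mul_comm _ c, avg_mul_left]

lemma avg_sum {σ : Type*} (F : Finset ι) (s : Finset σ) (f : σ → Set ι → ℝ) :
    avg F (fun T => ∑ i ∈ s, f i T) = ∑ i ∈ s, avg F (f i) := by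
  simp only [avg, Finset.sum_div]
  rw [Finset.sum_comm]

lemma avg_add (F : Finset ι) (f g : Set ι → ℝ) :
    avg F (fun T => f T + g T) = avg F f + avg F g := by
  simp only [avg, Finset.sum_add_distrib, add_div]

lemma avg_empty (f : Set ι → ℝ) : avg ∅ f = f ∅ := by
  simp [avg]

lemma avg_insert [DecidableEq ι] {F : Finset ι} {a : ι} (ha : a ∉ F) (f : Set ι → ℝ) :
    avg (insert a F) f = (avg F f + avg F fun T => f (insert a T)) / 2 := by
  unfold avg
  rw [Finset.sum_powerset_insert ha, Finset.card_insert_of_notMem ha]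
  simp only [Finset.coe_insert]
  field_simp
  ring

lemma avg_union [DecidableEq ι] {F K : Finset ι} (h : Disjoint F K) (f : Set ι → ℝ) :
    avg (F ∪ K) f = avg F fun T => avg K fun S => f (T ∪ S) := by
  induction K using Finset.induction_on generalizing f with
  | empty => simp [avg_empty]
  | insert a K ha ih =>
    rw [Finset.disjoint_insert_right] at h
    have haF : a ∉ F ∪ K := by simp [h.1, ha]
    have e : F ∪ insert a K = insert a (F ∪ K) := by ext; simp
    rw [e, avg_insert haF, ih h.2, ih h.2, ← avg_add]
    simp only [avg_insert ha, Set.union_insert]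
    simp only [div_eq_mul_inv]
    rw [avg_mul_right]

lemma avg_map (F : Finset κ) (g : κ ↪ ι) (f : Set ι → ℝ) :
    avg (F.map g) f = avg F fun T => f (g '' T) := by
  classical
  unfold avg
  rw [Finset.card_map]
  congr 1
  refine (Finset.sum_bij (fun T _ => T.map g) ?_ ?_ ?_ ?_).symm
  · intro T hT
    simpa using hT
  · intro T _ T' _ h
    exact Finset.map_injective g h
  · intro T hT
    rw [Finset.mem_powerset, Finset.subset_map_iff] at hT
    obtain ⟨u, hu, rfl⟩ := hT
    exact ⟨u, by simpa using hu, rfl⟩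
  · intro T _
    simp

/-- Irrelevant coordinates average out. This makes `pr` independent of the chosen finite support, so
that no infinite product measure is needed. -/
lemma prob_eq_of_subset {F F' : Finset ι} {A : Set ι → Prop} (hA : LocalOn (F : Set ι) A)
    (h : F ⊆ F') : prob F' A = prob F A := by
  classical
  unfold prob
  rw [← Finset.union_sdiff_of_subset h, avg_union Finset.disjoint_sdiff]
  refine avg_congr fun T hT => ?_
  rw [← avg_const (F' \ F) (if A T then 1 else 0)]
  refine avg_congr fun S hS => ?_
  rw [hA (T ∪ S) T]
  ext e
  simp only [Set.mem_inter_iff, Set.mem_union]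
  refine ⟨?_, fun h => ⟨Or.inl h.1, h.2⟩⟩
  rintro ⟨h1 | h1, h2⟩
  · exact ⟨h1, h2⟩
  · have := hS h1
    simp at this h2
    exact absurd h2 this.2

open Classical in
/-- The probability of a local event under fair percolation. -/
noncomputable def pr (A : Set ι → Prop) : ℝ :=
  if h : ∃ F : Finset ι, LocalOn (F : Set ι) A then prob h.choose A else 0

lemma pr_eq {F : Finset ι} {A : Set ι → Prop} (hA : LocalOn (F : Set ι) A) :
    pr A = prob F A := by
  classical
  have h : ∃ F : Finset ι, LocalOn (F : Set ι) A := ⟨F, hA⟩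
  rw [pr, dif_pos h, ← prob_eq_of_subset hA Finset.subset_union_right,
    prob_eq_of_subset h.choose_spec Finset.subset_union_left]

/-- The event `A` depends on finitely many elements. -/
def IsLocal (A : Set ι → Prop) : Prop := ∃ F : Finset ι, LocalOn (F : Set ι) A

lemma LocalOn.isLocal {E : Set ι} {A : Set ι → Prop} (h : LocalOn E A) (hE : E.Finite) :
    IsLocal A := ⟨hE.toFinset, by simpa using h⟩

lemma IsLocal.exists_common {A B : Set ι → Prop} (hA : IsLocal A) (hB : IsLocal B) :
    ∃ F : Finset ι, LocalOn (F : Set ι) A ∧ LocalOn (F : Set ι) B := by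
  classical
  obtain ⟨F, hF⟩ := hA
  obtain ⟨K, hK⟩ := hB
  exact ⟨F ∪ K, hF.mono (by simp), hK.mono (by simp)⟩

lemma IsLocal.and {A B : Set ι → Prop} (hA : IsLocal A) (hB : IsLocal B) :
    IsLocal fun T => A T ∧ B T := by
  obtain ⟨F, h1, h2⟩ := hA.exists_common hB
  exact ⟨F, h1.and h2⟩

lemma prob_mono {F : Finset ι} {A B : Set ι → Prop} (h : ∀ T : Set ι, T ⊆ F → A T → B T) :
    prob F A ≤ prob F B := by
  refine avg_mono fun T hT => ?_
  have := h T hT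
  split_ifs <;> simp_all

lemma prob_not (F : Finset ι) (A : Set ι → Prop) : prob F (fun T => ¬ A T) = 1 - prob F A := by
  classical
  have : prob F A + prob F (fun T => ¬ A T) = 1 := by
    unfold prob
    rw [← avg_add]
    refine Eq.trans ?_ (avg_const F 1)
    refine avg_congr fun T _ => ?_
    by_cases h : A T <;> simp [h]
  linarith

lemma prob_nonneg (F : Finset ι) (A : Set ι → Prop) : 0 ≤ prob F A := by
  rw [← avg_const F 0]
  refine avg_mono fun T _ => ?_
  split_ifs <;> simp

lemma pr_nonneg (A : Set ι → Prop) : 0 ≤ pr A := by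
  unfold pr
  split_ifs
  · exact prob_nonneg _ _
  · exact le_rfl

lemma pr_mono {A B : Set ι → Prop} (hA : IsLocal A) (hB : IsLocal B) (h : ∀ T, A T → B T) :
    pr A ≤ pr B := by
  obtain ⟨F, h1, h2⟩ := hA.exists_common hB
  rw [pr_eq h1, pr_eq h2]
  exact prob_mono fun T _ => h T

lemma pr_not {A : Set ι → Prop} (hA : IsLocal A) : pr (fun T => ¬ A T) = 1 - pr A := by
  obtain ⟨F, h1⟩ := hA
  rw [pr_eq h1, pr_eq h1.not, prob_not]

lemma pr_le_add {A B C : Set ι → Prop} (hA : IsLocal A) (hB : IsLocal B) (hC : IsLocal C)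
    (h : ∀ T, A T → B T ∨ C T) : pr A ≤ pr B + pr C := by
  classical
  obtain ⟨F, h1⟩ := hA
  obtain ⟨K, h2, h3⟩ := hB.exists_common hC
  have h1' : LocalOn (F ∪ K : Finset ι) A := h1.mono (by simp)
  have h2' : LocalOn (F ∪ K : Finset ι) B := h2.mono (by simp)
  have h3' : LocalOn (F ∪ K : Finset ι) C := h3.mono (by simp)
  rw [pr_eq h1', pr_eq h2', pr_eq h3', prob, prob, prob, ← avg_add]
  refine avg_mono fun T _ => ?_
  have := h T
  split_ifs <;> simp_all

lemma pr_and_of_disjoint {E E' : Set ι} {A B : Set ι → Prop} (hA : LocalOn E A)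
    (hB : LocalOn E' B) (hE : E.Finite) (hE' : E'.Finite) (hd : Disjoint E E') :
    pr (fun T => A T ∧ B T) = pr A * pr B := by
  classical
  lift E to Finset ι using hE
  lift E' to Finset ι using hE'
  have hd' : Disjoint E E' := by exact_mod_cast hd
  have hAB : LocalOn ((E ∪ E' : Finset ι) : Set ι) fun T => A T ∧ B T :=
    (hA.mono (by simp)).and (hB.mono (by simp))
  rw [pr_eq hAB, pr_eq hA, pr_eq hB, prob, avg_union hd', prob, prob, ← avg_mul_right]
  refine avg_congr fun T hT => ?_
  rw [← avg_mul_left]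
  refine avg_congr fun S hS => ?_
  have h1 : A (T ∪ S) ↔ A T := hA _ _ (by
    rw [Set.union_inter_distrib_right, (hd.symm.mono_left hS).inter_eq, Set.union_empty])
  have h2 : B (T ∪ S) ↔ B S := hB _ _ (by
    rw [Set.union_inter_distrib_right, (hd.mono_left hT).inter_eq, Set.empty_union])
  simp only [h1, h2]
  split_ifs <;> simp_all

lemma pr_comp_image {A : Set ι → Prop} (g : κ ↪ ι) {E : Set κ} (hE : E.Finite)
    (hA : LocalOn (g '' E) A) : pr (fun T => A (g '' T)) = pr A := by
  classical
  lift E to Finset κ using hE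
  have h1 : LocalOn ((E.map g : Finset ι) : Set ι) A := by simpa using hA
  have h2 : LocalOn (E : Set κ) fun T => A (g '' T) := fun T T' h => hA _ _ (by
    rw [← Set.image_inter g.injective, ← Set.image_inter g.injective, h])
  rw [pr_eq h1, pr_eq h2, prob, prob, avg_map]

/-- Decreasing events are positively correlated. -/
lemma pr_mul_le_pr_and {A B : Set ι → Prop} (hA : IsLocal A) (hB : IsLocal B)
    (hA' : IsLowerSet {T | A T}) (hB' : IsLowerSet {T | B T}) :
    pr A * pr B ≤ pr fun T => A T ∧ B T := by
  classical
  obtain ⟨F, h1, h2⟩ := hA.exists_common hB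
  rw [pr_eq h1, pr_eq h2, pr_eq (h1.and h2)]
  -- Kleitman's inequality for down-sets of a finite cube is Harris' inequality for the uniform
  -- measure.
  have key := IsLowerSet.le_card_inter_finset' (s := F)
    (𝒜 := (F.powerset.filter fun T : Finset ι => A (T : Set ι))) (ℬ := (F.powerset.filter fun T : Finset ι => B (T : Set ι)))
    (fun S T hTS hS => by
      simp only [Finset.coe_filter, Finset.mem_powerset, Set.mem_ofPred_eq] at hS ⊢
      exact ⟨hTS.trans hS.1, hA' (Finset.coe_subset.2 hTS) hS.2⟩)
    (fun S T hTS hS => by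
      simp only [Finset.coe_filter, Finset.mem_powerset, Set.mem_ofPred_eq] at hS ⊢
      exact ⟨hTS.trans hS.1, hB' (Finset.coe_subset.2 hTS) hS.2⟩)
    (fun T hT => by simpa using (Finset.mem_filter.1 hT).1)
    (fun T hT => by simpa using (Finset.mem_filter.1 hT).1)
  rw [← Finset.filter_and] at key
  have e : ∀ C : Set ι → Prop,
      prob F C = ((F.powerset.filter fun T : Finset ι => C (T : Set ι)).card : ℝ) / 2 ^ F.card := by
    intro C
    simp [prob, avg, Finset.sum_boole]
  rw [e, e, e, div_mul_div_comm, div_le_div_iff₀ (by positivity) (by positivity)]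
  have key' : ((F.powerset.filter fun T : Finset ι => A (T : Set ι)).card : ℝ) * (F.powerset.filter fun T : Finset ι => B (T : Set ι)).card
      ≤ 2 ^ F.card * (F.powerset.filter fun T : Finset ι => A (T : Set ι) ∧ B (T : Set ι)).card := by
    exact_mod_cast key
  have := mul_le_mul_of_nonneg_right key' (by positivity : (0 : ℝ) ≤ 2 ^ F.card)
  refine this.trans (le_of_eq ?_)
  rw [mul_comm (2 ^ F.card) (Nat.cast _ : ℝ), mul_assoc]
  congr!

/-- If a local random variable `c` takes values in a finite set, and each event `{c = a}` is
independent of an event `G a` of probability at least `q`, then `G c` has probability at least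
`q` given that `c` lies in a set `s`. -/
lemma mul_pr_le_pr_of_indep {σ : Type*} (c : Set ι → σ) (s : Finset σ) (G : σ → Set ι → Prop)
    {A : Set ι → Prop} (q : ℝ)
    (hc : ∀ a ∈ s, IsLocal fun T => c T = a) (hG : ∀ a ∈ s, IsLocal (G a))
    (hind : ∀ a ∈ s, pr (fun T => c T = a ∧ G a T) = pr (fun T => c T = a) * pr (G a))
    (hq : ∀ a ∈ s, q ≤ pr (G a)) (hA : IsLocal A) (hB : IsLocal fun T => c T ∈ s)
    (h : ∀ T, ∀ a ∈ s, c T = a → G a T → A T) :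
    q * pr (fun T => c T ∈ s) ≤ pr A := by
  classical
  obtain ⟨F0, h1, h2⟩ := hA.exists_common hB
  choose! Fc hFc using hc
  choose! FG hFG using hG
  set F := F0 ∪ s.biUnion Fc ∪ s.biUnion FG with hF
  have s1 : F0 ⊆ F := by rw [hF]; intro x; simp +contextual
  have s2 : ∀ a ∈ s, Fc a ⊆ F := by
    intro a ha x hx
    rw [hF]
    simp only [Finset.mem_union, Finset.mem_biUnion]
    exact Or.inl (Or.inr ⟨a, ha, hx⟩)
  have s3 : ∀ a ∈ s, FG a ⊆ F := by
    intro a ha x hx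
    rw [hF]
    simp only [Finset.mem_union, Finset.mem_biUnion]
    exact Or.inr ⟨a, ha, hx⟩
  have l1 : LocalOn (F : Set ι) A := h1.mono (Finset.coe_subset.2 s1)
  have l2 : LocalOn (F : Set ι) fun T => c T ∈ s := h2.mono (Finset.coe_subset.2 s1)
  have l3 : ∀ a ∈ s, LocalOn (F : Set ι) fun T => c T = a :=
    fun a ha => (hFc a ha).mono (Finset.coe_subset.2 (s2 a ha))
  have l4 : ∀ a ∈ s, LocalOn (F : Set ι) (G a) :=
    fun a ha => (hFG a ha).mono (Finset.coe_subset.2 (s3 a ha))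
  have e1 : pr (fun T => c T ∈ s) = ∑ a ∈ s, pr fun T => c T = a := by
    rw [pr_eq l2, Finset.sum_congr rfl fun a ha => pr_eq (l3 a ha)]
    unfold prob
    rw [← avg_sum]
    refine avg_congr fun T _ => ?_
    have := Finset.sum_ite_eq s (c T) fun _ => (1 : ℝ)
    by_cases h : c T ∈ s <;> simp_all
  -- The events `c = a ∧ G a` are disjoint for distinct `a`, and each of them implies `A`.
  have e2 : ∑ a ∈ s, pr (fun T => c T = a ∧ G a T) ≤ pr A := by
    rw [pr_eq l1, Finset.sum_congr rfl fun a ha => pr_eq ((l3 a ha).and (l4 a ha))]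
    unfold prob
    rw [← avg_sum]
    refine avg_mono fun T _ => ?_
    by_cases hT : c T ∈ s ∧ G (c T) T
    · rw [if_pos (h T _ hT.1 rfl hT.2)]
      rw [Finset.sum_eq_single (c T)]
      · split_ifs <;> simp
      · intro b _ hb
        rw [if_neg]
        exact fun h => hb h.1.symm
      · exact fun h => absurd hT.1 h
    · rw [Finset.sum_eq_zero]
      · split_ifs <;> simp
      · intro a ha
        rw [if_neg]
        rintro ⟨rfl, h⟩
        exact hT ⟨ha, h⟩
  refine le_trans ?_ e2
  rw [e1, Finset.mul_sum]
  refine Finset.sum_le_sum fun a ha => ?_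
  rw [hind a ha, mul_comm]
  exact mul_le_mul_of_nonneg_left (hq a ha) (pr_nonneg _)

end FairPercolation

/-! ### Planar topology of lattice walks through crossing parity. -/

section PlanarTopology

lemma squareLattice_adj {u v : ℤ × ℤ} : squareLattice.Adj u v ↔
    (u.2 = v.2 ∧ (u.1 = v.1 + 1 ∨ v.1 = u.1 + 1)) ∨
    (u.1 = v.1 ∧ (u.2 = v.2 + 1 ∨ v.2 = u.2 + 1)) := by
  change |u.1 - v.1| + |u.2 - v.2| = 1 ↔ _
  rcases abs_cases (u.1 - v.1) with ⟨h, _⟩ | ⟨h, _⟩ <;>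
  rcases abs_cases (u.2 - v.2) with ⟨h', _⟩ | ⟨h', _⟩ <;> rw [h, h'] <;> omega

/-- The parity of the number of vertical steps of a walk that cross the horizontal half-line
going left from the point `v + (0, 1/2)`. -/
def crossingParity : {p q : ℤ × ℤ} → squareLattice.Walk p q → ℤ × ℤ → ZMod 2
  | _, _, .nil, _ => 0
  | _, _, .cons (u := u) (v := w) _ γ, v =>
    (if u.1 < v.1 ∧ u.2 ≠ w.2 ∧ min u.2 w.2 = v.2 then 1 else 0) + crossingParity γ v

variable {p q : ℤ × ℤ}

/-- Lengthening the half-line by one unit could only add vertical steps through `(x, y)`, which the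
walk avoids. -/
lemma crossingParity_right (γ : squareLattice.Walk p q) {x y : ℤ} (h : (x, y) ∉ γ.support) :
    crossingParity γ (x + 1, y) = crossingParity γ (x, y) := by
  induction γ with
  | nil => rfl
  | @cons u w q hu γ ih =>
    rw [SimpleGraph.Walk.support_cons, List.mem_cons, not_or] at h
    have hw : (x, y) ≠ w := fun e => h.2 (e ▸ γ.start_mem_support)
    rw [crossingParity, crossingParity, ih h.2]
    congr 1
    rw [squareLattice_adj] at hu
    have h1 := h.1
    simp only [ne_eq, Prod.ext_iff] at h1 hw
    simp only at h1 hw ⊢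
    refine if_congr ?_ rfl rfl
    omega

/-- The left side counts the vertical steps entering or leaving the part of row `y + 1` strictly
left of `x`. As the walk avoids `(x, y + 1)`, it has no other way in or out of that half-row, so the
parity only depends on whether its endpoints lie there. -/
lemma crossingParity_up (γ : squareLattice.Walk p q) {x y : ℤ} (h : (x, y + 1) ∉ γ.support) :
    crossingParity γ (x, y) + crossingParity γ (x, y + 1) =
      (if p.1 < x ∧ p.2 = y + 1 then 1 else 0) + (if q.1 < x ∧ q.2 = y + 1 then 1 else 0) := by
  induction γ with
  | nil =>
    simp only [crossingParity]
    split_ifs <;> decide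
  | @cons u w q hu γ ih =>
    rw [SimpleGraph.Walk.support_cons, List.mem_cons, not_or] at h
    have hw : (x, y + 1) ≠ w := fun e => h.2 (e ▸ γ.start_mem_support)
    rw [crossingParity, crossingParity, add_add_add_comm, ih h.2, ← add_assoc]
    congr 1
    rw [squareLattice_adj] at hu
    have h1 := h.1
    simp only [ne_eq, Prod.ext_iff] at h1 hw
    simp only at h1 hw ⊢
    split_ifs <;> first | rfl | omega

lemma crossingParity_of_le (γ : squareLattice.Walk p q) {v : ℤ × ℤ}
    (h : ∀ z ∈ γ.support, v.1 ≤ z.1) : crossingParity γ v = 0 := by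
  induction γ with
  | nil => rfl
  | @cons u w q hu γ ih =>
    simp only [SimpleGraph.Walk.support_cons, List.mem_cons, forall_eq_or_imp] at h
    rw [crossingParity, ih h.2, if_neg, add_zero]
    intro h'
    omega

/-- Every passage of the walk between heights `v.2` and `v.2 + 1` is counted: none is to the right
of `v`, and none is above `v` itself since `v` is avoided. -/
lemma crossingParity_of_ge (γ : squareLattice.Walk p q) {v : ℤ × ℤ}
    (h : ∀ z ∈ γ.support, z.1 ≤ v.1) (hv : v ∉ γ.support) : crossingParity γ v =
      (if p.2 ≤ v.2 then 1 else 0) + (if q.2 ≤ v.2 then 1 else 0) := by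
  induction γ with
  | nil =>
    simp only [crossingParity]
    split_ifs <;> decide
  | @cons u w q hu γ ih =>
    simp only [SimpleGraph.Walk.support_cons, List.mem_cons, forall_eq_or_imp, not_or] at h hv
    have hw : v ≠ w := fun e => hv.2 (e ▸ γ.start_mem_support)
    have hw' := h.2 w γ.start_mem_support
    rw [crossingParity, ih h.2 hv.2]
    rw [squareLattice_adj] at hu
    have h1 := hv.1
    simp only [ne_eq, Prod.ext_iff] at h1 hw
    have h2 := h.1
    split_ifs <;> first | rfl | omega

/-- The points `a` and `b` are joined by a lattice walk inside `K`. -/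
def Linked (K : Set (ℤ × ℤ)) (a b : ℤ × ℤ) : Prop :=
  ∃ γ : squareLattice.Walk a b, ∀ z ∈ γ.support, z ∈ K

lemma Linked.refl {K : Set (ℤ × ℤ)} {a : ℤ × ℤ} (h : a ∈ K) : Linked K a a :=
  ⟨.nil, by simpa using h⟩

lemma Linked.symm {K : Set (ℤ × ℤ)} {a b : ℤ × ℤ} (h : Linked K a b) : Linked K b a := by
  obtain ⟨γ, h⟩ := h
  exact ⟨γ.reverse, by simpa using h⟩

lemma Linked.trans {K : Set (ℤ × ℤ)} {a b c : ℤ × ℤ} (h : Linked K a b) (h' : Linked K b c) :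
    Linked K a c := by
  obtain ⟨γ, h⟩ := h
  obtain ⟨γ', h'⟩ := h'
  refine ⟨γ.append γ', fun z hz => ?_⟩
  rw [SimpleGraph.Walk.mem_support_append_iff] at hz
  exact hz.elim (h z) (h' z)

lemma Linked.mono {K K' : Set (ℤ × ℤ)} {a b : ℤ × ℤ} (h : Linked K a b) (hK : K ⊆ K') :
    Linked K' a b := by
  obtain ⟨γ, h⟩ := h
  exact ⟨γ, fun z hz => hK (h z hz)⟩

lemma Linked.of_adj {K : Set (ℤ × ℤ)} {a b : ℤ × ℤ} (ha : a ∈ K) (hb : b ∈ K)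
    (h : squareLattice.Adj a b) : Linked K a b :=
  ⟨.cons h .nil, by simp [ha, hb]⟩

lemma Linked.right_mem {K : Set (ℤ × ℤ)} {a b : ℤ × ℤ} (h : Linked K a b) : b ∈ K := by
  obtain ⟨γ, h⟩ := h
  exact h _ γ.end_mem_support

lemma Linked.image {K : Set (ℤ × ℤ)} {a b : ℤ × ℤ} (h : Linked K a b) (g : ℤ × ℤ → ℤ × ℤ)
    (hg : ∀ u v, squareLattice.Adj u v → squareLattice.Adj (g u) (g v)) :
    Linked (g '' K) (g a) (g b) := by
  obtain ⟨γ, h⟩ := h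
  refine ⟨γ.map ⟨g, fun {u v} h => hg u v h⟩, fun z hz => ?_⟩
  rw [SimpleGraph.Walk.support_map, List.mem_map] at hz
  obtain ⟨w, hw, rfl⟩ := hz
  exact ⟨w, h w hw, rfl⟩

lemma linked_row {K : Set (ℤ × ℤ)} {a b y : ℤ} (hab : a ≤ b)
    (h : ∀ x, a ≤ x → x ≤ b → (x, y) ∈ K) : Linked K (a, y) (b, y) := by
  induction b, hab using Int.leInduction with
  | base => exact .refl (h a le_rfl le_rfl)
  | succ b hb ih =>
    exact (ih fun x h1 h2 => h x h1 (by omega)).trans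
      (.of_adj (h b hb (by omega)) (h _ (by omega) le_rfl) (by simp [squareLattice_adj]))

lemma linked_col {K : Set (ℤ × ℤ)} {a b x : ℤ} (hab : a ≤ b)
    (h : ∀ y, a ≤ y → y ≤ b → (x, y) ∈ K) : Linked K (x, a) (x, b) := by
  induction b, hab using Int.leInduction with
  | base => exact .refl (h a le_rfl le_rfl)
  | succ b hb ih =>
    exact (ih fun x h1 h2 => h x h1 (by omega)).trans
      (.of_adj (h b hb (by omega)) (h _ (by omega) le_rfl) (by simp [squareLattice_adj]))

/-- A bottom-top walk and a left-right walk of a rectangle intersect. -/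
lemma inter_nonempty_of_linked {K K' : Set (ℤ × ℤ)} {x₀ x₁ y₀ y₁ : ℤ} {p q a b : ℤ × ℤ}
    (hK : ∀ z ∈ K, x₀ ≤ z.1 ∧ z.1 ≤ x₁ ∧ y₀ ≤ z.2 ∧ z.2 ≤ y₁)
    (hK' : ∀ z ∈ K', x₀ ≤ z.1 ∧ z.1 ≤ x₁ ∧ y₀ ≤ z.2 ∧ z.2 ≤ y₁)
    (hpq : Linked K p q) (hab : Linked K' a b) (hp : p.2 = y₀) (hq : q.2 = y₁)
    (ha : a.1 = x₀) (hb : b.1 = x₁) : (K ∩ K').Nonempty := by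
  by_contra hne
  obtain ⟨γ, hγ⟩ := hpq
  obtain ⟨δ, hδ⟩ := hab
  have hd : ∀ z ∈ K', z ∉ γ.support := fun z hz hz' => hne ⟨z, hγ z hz', hz⟩
  have hq' := hK q (hγ q γ.end_mem_support)
  have hqs := γ.end_mem_support
  -- The second summand is what an extra vertical step above `q` would contribute. With the walk
  -- prolonged out of the rectangle in this way, the parity is constant along any walk that avoids
  -- it.
  have key : ∀ {c d : ℤ × ℤ} (σ : squareLattice.Walk c d), (∀ z ∈ σ.support, z ∈ K') →
      crossingParity γ c + (if q.1 < c.1 ∧ c.2 = y₁ then 1 else 0) =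
      crossingParity γ d + (if q.1 < d.1 ∧ d.2 = y₁ then 1 else 0) := by
    intro c d σ hσ
    induction σ with
    | nil => rfl
    | @cons u w d hu σ ih =>
      simp only [SimpleGraph.Walk.support_cons, List.mem_cons, forall_eq_or_imp] at hσ
      rw [← ih hσ.2]
      have hw : w ∈ K' := hσ.2 w σ.start_mem_support
      have right : ∀ x y : ℤ, (x, y) ∈ K' →
          crossingParity γ (x, y) + (if q.1 < x ∧ y = y₁ then 1 else 0) =
          crossingParity γ (x + 1, y) + (if q.1 < x + 1 ∧ y = y₁ then 1 else 0) := by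
        intro x y h
        rw [crossingParity_right γ (hd _ h)]
        congr 1
        refine if_congr ?_ rfl rfl
        have : (x, y) ≠ q := fun e => hd _ h (e ▸ hqs)
        rw [Ne, Prod.ext_iff] at this
        simp only at this
        omega
      have up : ∀ x y : ℤ, (x, y) ∈ K' → (x, y + 1) ∈ K' →
          crossingParity γ (x, y) + (if q.1 < x ∧ y = y₁ then 1 else 0) =
          crossingParity γ (x, y + 1) + (if q.1 < x ∧ y + 1 = y₁ then 1 else 0) := by
        intro x y h h'
        have e := crossingParity_up γ (hd _ h')
        have h1 := hK' _ h
        have h2 := hK' _ h'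
        simp only at h1 h2
        rw [if_neg (by omega), zero_add] at e
        rw [if_neg (by omega), eq_sub_of_add_eq e, ← hq]
        simp only [eq_comm (a := y + 1), CharTwo.sub_eq_add]
        ring
      obtain ⟨u1, u2⟩ := u
      obtain ⟨w1, w2⟩ := w
      rw [squareLattice_adj] at hu
      simp only at hu ⊢
      rcases hu with ⟨rfl, rfl | rfl⟩ | ⟨rfl, rfl | rfl⟩
      · exact (right _ _ hw).symm
      · exact right _ _ hσ.1
      · exact (up _ _ hw hσ.1).symm
      · exact up _ _ hσ.1 hw
  -- The invariant is 0 at the left end and 1 at the right end, a contradiction.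
  have h := key δ hδ
  have haK := hδ a δ.start_mem_support
  have hbK := hδ b δ.end_mem_support
  rw [crossingParity_of_le γ fun z hz => ha ▸ (hK z (hγ z hz)).1,
    crossingParity_of_ge γ (fun z hz => hb ▸ (hK z (hγ z hz)).2.1) (hd b hbK)] at h
  have hbq : b ≠ q := fun e => hd _ hbK (e ▸ hqs)
  rw [Ne, Prod.ext_iff] at hbq
  have := hK' b hbK
  rw [if_neg (by omega), if_pos (by omega)] at h
  by_cases hby : b.2 = y₁
  · rw [if_pos (by omega), if_pos (by omega)] at h
    revert h; decide
  · rw [if_neg (by omega), if_neg (by omega)] at h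
    revert h; decide

/-- In a rectangle, a walk from the bottom side to a point of the left side intersects every
walk from the top side to a lower point of the left side. -/
lemma inter_nonempty_of_linked_left {K K' : Set (ℤ × ℤ)} {m n c d a b : ℤ}
    (hK : ∀ z ∈ K, 0 ≤ z.1 ∧ z.1 ≤ m ∧ 0 ≤ z.2 ∧ z.2 ≤ n)
    (hK' : ∀ z ∈ K', 0 ≤ z.1 ∧ z.1 ≤ m ∧ 0 ≤ z.2 ∧ z.2 ≤ n)
    (h : Linked K (0, a) (c, 0)) (h' : Linked K' (d, n) (0, b)) (hba : b < a) :
    (K' ∩ K).Nonempty := by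
  have hc := hK _ h.right_mem
  have ha := hK _ h.symm.right_mem
  have hb := hK' _ h'.right_mem
  simp only at hc ha hb
  -- Both walks are prolonged outside the rectangle to cross `[-2, m + 1] × [-1, n]`: the first
  -- leaves along row `a` to the left and along row `-1` to the right, the second goes down column
  -- `-1` from height `b`. The added pieces do not meet because `b < a` and `0 ≤ c`.
  set L : Set (ℤ × ℤ) := K ∪ {z | (z.2 = a ∧ -2 ≤ z.1 ∧ z.1 < 0) ∨
    (z.2 = -1 ∧ c ≤ z.1 ∧ z.1 ≤ m + 1)} with hL
  set L' : Set (ℤ × ℤ) := K' ∪ {z | z.1 = -1 ∧ -1 ≤ z.2 ∧ z.2 ≤ b} with hL'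
  have e1 : Linked L (-2, a) (m + 1, -1) := by
    have s1 : Linked L (-2, a) (-1, a) := linked_row (by omega) fun x _ _ =>
      Or.inr (Or.inl ⟨rfl, by simp only; omega, by simp only; omega⟩)
    have s2 : Linked L (-1, a) (0, a) := .of_adj s1.right_mem (Or.inl h.symm.right_mem)
      (by simp [squareLattice_adj])
    have s4 : Linked L (c, -1) (m + 1, -1) := linked_row (by omega) fun x _ _ =>
      Or.inr (Or.inr ⟨rfl, by simp only; omega, by simp only; omega⟩)
    have s3 : Linked L (c, 0) (c, -1) := .of_adj (Or.inl h.right_mem) s4.symm.right_mem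
      (by simp [squareLattice_adj])
    exact ((s1.trans s2).trans (h.mono (Set.subset_union_left))).trans (s3.trans s4)
  have e2 : Linked L' (-1, -1) (d, n) := by
    have s1 : Linked L' (-1, -1) (-1, b) := linked_col (by omega) fun x _ _ =>
      Or.inr ⟨rfl, by simp only; omega, by simp only; omega⟩
    have s2 : Linked L' (-1, b) (0, b) := .of_adj s1.right_mem (Or.inl h'.right_mem)
      (by simp [squareLattice_adj])
    exact (s1.trans s2).trans (h'.symm.mono (Set.subset_union_left))
  have hLb : ∀ z ∈ L, -2 ≤ z.1 ∧ z.1 ≤ m + 1 ∧ -1 ≤ z.2 ∧ z.2 ≤ n := by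
    rintro z (hz | hz | hz)
    · have := hK z hz; omega
    · omega
    · omega
  have hLb' : ∀ z ∈ L', -2 ≤ z.1 ∧ z.1 ≤ m + 1 ∧ -1 ≤ z.2 ∧ z.2 ≤ n := by
    rintro z (hz | hz)
    · have := hK' z hz; omega
    · obtain ⟨h1, h2, h3⟩ := hz; omega
  obtain ⟨z, hz', hz⟩ := inter_nonempty_of_linked hLb' hLb e2 e1 rfl rfl rfl rfl
  rcases hz' with hz' | ⟨h1, h2, h3⟩
  · rcases hz with hz | hz | hz
    · exact ⟨z, hz', hz⟩
    · have := hK' z hz'; omega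
    · have := hK' z hz'; omega
  · rcases hz with hz | hz | hz
    · have := hK z hz; omega
    · omega
    · omega

end PlanarTopology

/-! ### Blocked crossings, their certificates, locality and lattice symmetries. -/

section Blocking

/-- The edge `{u, v}`, encoded by its doubled midpoint `u + v`, belongs to `ω`. -/
def IsOpenEdge (ω : Set (ℤ × ℤ)) (u v : ℤ × ℤ) : Prop := squareLattice.Adj u v ∧ u + v ∈ ω

lemma IsOpenEdge.symm {ω : Set (ℤ × ℤ)} {u v : ℤ × ℤ} (h : IsOpenEdge ω u v) :
    IsOpenEdge ω v u := ⟨h.1.symm, add_comm u v ▸ h.2⟩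

lemma IsOpenEdge.mono {ω ω' : Set (ℤ × ℤ)} {u v : ℤ × ℤ} (h : IsOpenEdge ω u v) (hω : ω ⊆ ω') :
    IsOpenEdge ω' u v := ⟨h.1, hω h.2⟩

/-- There is no open path in `D` from `s` to `t`: some set of points of `D` which is closed under
open steps inside `D` contains `s` and misses `t`. -/
def Block (D s t : Set (ℤ × ℤ)) (ω : Set (ℤ × ℤ)) : Prop :=
  ∃ B : Set (ℤ × ℤ), B ⊆ D ∧ (∀ u ∈ D, u ∈ s → u ∈ B) ∧ (∀ u ∈ B, u ∉ t) ∧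
    ∀ u ∈ B, ∀ v ∈ D, IsOpenEdge ω u v → v ∈ B

/-- The points of `D` that open paths in `D` join to `s`. -/
def reach (D s : Set (ℤ × ℤ)) (ω : Set (ℤ × ℤ)) : Set (ℤ × ℤ) :=
  {v | ∃ a ∈ D, a ∈ s ∧ Relation.ReflTransGen (fun u v => IsOpenEdge ω u v ∧ v ∈ D) a v}

/-- The edges between points of `D`. -/
def edgesIn (D : Set (ℤ × ℤ)) : Set (ℤ × ℤ) :=
  {m | ∃ u ∈ D, ∃ v ∈ D, squareLattice.Adj u v ∧ u + v = m}

lemma edgesIn_mono {D D' : Set (ℤ × ℤ)} (h : D ⊆ D') : edgesIn D ⊆ edgesIn D' := by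
  rintro m ⟨u, hu, v, hv, h'⟩
  exact ⟨u, h hu, v, h hv, h'⟩

lemma finite_edgesIn {D : Set (ℤ × ℤ)} (h : D.Finite) : (edgesIn D).Finite := by
  refine ((h.prod h).image fun p => p.1 + p.2).subset ?_
  rintro m ⟨u, hu, v, hv, -, rfl⟩
  exact ⟨(u, v), ⟨hu, hv⟩, rfl⟩

variable {D s t : Set (ℤ × ℤ)} {ω : Set (ℤ × ℤ)}

lemma reach_subset : reach D s ω ⊆ D := by
  rintro v ⟨a, ha, -, h⟩
  induction h with
  | refl => exact ha
  | tail _ h _ => exact h.2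

lemma mem_reach_of_mem {u : ℤ × ℤ} (h : u ∈ D) (h' : u ∈ s) : u ∈ reach D s ω :=
  ⟨u, h, h', .refl⟩

lemma mem_reach_of_open {u v : ℤ × ℤ} (hu : u ∈ reach D s ω) (hv : v ∈ D)
    (h : IsOpenEdge ω u v) : v ∈ reach D s ω := by
  obtain ⟨a, ha, has, hau⟩ := hu
  exact ⟨a, ha, has, hau.tail ⟨h, hv⟩⟩

/-- Open steps are reversible, so a set closed under them can be followed backwards from a reached
point to its source. -/
lemma exists_mem_of_mem_reach {B : Set (ℤ × ℤ)} {z : ℤ × ℤ} (hz : z ∈ B) (h : z ∈ reach D s ω)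
    (hB : ∀ u ∈ B, ∀ v ∈ D, IsOpenEdge ω u v → v ∈ B) : ∃ b ∈ D, b ∈ s ∧ b ∈ B := by
  obtain ⟨a, ha, has, h⟩ := h
  induction h with
  | refl => exact ⟨a, ha, has, hz⟩
  | @tail y z hy h ih =>
    exact ih (hB z hz y (reach_subset ⟨a, ha, has, hy⟩) h.1.symm)

lemma linked_of_mem_reach {v : ℤ × ℤ} (h : v ∈ reach D s ω) :
    ∃ a ∈ D, a ∈ s ∧ Linked (reach D s ω) a v := by
  obtain ⟨a, ha, has, h⟩ := h
  refine ⟨a, ha, has, ?_⟩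
  induction h with
  | refl => exact .refl (mem_reach_of_mem ha has)
  | @tail y z hy h ih =>
    exact ih.trans (.of_adj ih.right_mem (mem_reach_of_open ih.right_mem h.2 h.1) h.1.1)

/-- The cluster of `s` is the smallest candidate certificate. -/
lemma block_iff_reach : Block D s t ω ↔ ∀ u ∈ reach D s ω, u ∉ t := by
  constructor
  · rintro ⟨B, hBD, hs, ht, hB⟩ u ⟨a, ha, has, h⟩
    suffices u ∈ B from ht u this
    induction h with
    | refl => exact hs a ha has
    | tail _ h ih => exact hB _ ih _ h.2 h.1
  · exact fun h => ⟨reach D s ω, reach_subset, fun u => mem_reach_of_mem, h,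
      fun u hu v hv => mem_reach_of_open hu hv⟩

lemma isOpenEdge_iff_of_inter {ω' : Set (ℤ × ℤ)} (h : ω ∩ edgesIn D = ω' ∩ edgesIn D)
    {u v : ℤ × ℤ} (hu : u ∈ D) (hv : v ∈ D) : IsOpenEdge ω u v ↔ IsOpenEdge ω' u v := by
  refine and_congr_right fun hadj => ?_
  have hm : u + v ∈ edgesIn D := ⟨u, hu, v, hv, hadj, rfl⟩
  constructor
  · exact fun hω => (h.subset ⟨hω, hm⟩).1
  · exact fun hω => (h.superset ⟨hω, hm⟩).1

lemma localOn_block : LocalOn (edgesIn D) (Block D s t) := by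
  have : ∀ ω ω' : Set (ℤ × ℤ), ω ∩ edgesIn D = ω' ∩ edgesIn D → Block D s t ω → Block D s t ω' := by
    rintro ω ω' h ⟨B, hBD, hs, ht, hB⟩
    exact ⟨B, hBD, hs, ht, fun u hu v hv huv =>
      hB u hu v hv ((isOpenEdge_iff_of_inter h (hBD hu) hv).2 huv)⟩
  exact fun ω ω' h => ⟨this ω ω' h, this ω' ω h.symm⟩

lemma isLowerSet_block : IsLowerSet {ω | Block D s t ω} := by
  rintro ω ω' h ⟨B, hBD, hs, ht, hB⟩
  exact ⟨B, hBD, hs, ht, fun u hu v hv huv => hB u hu v hv (huv.mono h)⟩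

/-- A symmetry of the square lattice together with its action on doubled midpoints. -/
structure LatticeSymm where
  onVertex : (ℤ × ℤ) ≃ (ℤ × ℤ)
  onEdge : (ℤ × ℤ) ≃ (ℤ × ℤ)
  adj_iff : ∀ u v, squareLattice.Adj (onVertex u) (onVertex v) ↔ squareLattice.Adj u v
  map_add : ∀ u v, onVertex u + onVertex v = onEdge (u + v)

namespace LatticeSymm

/-- The translation by `w`. -/
def translation (w : ℤ × ℤ) : LatticeSymm where
  onVertex := Equiv.addRight w
  onEdge := Equiv.addRight (w + w)
  adj_iff u v := by simp [squareLattice_adj]; omega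
  map_add u v := by simp only [Equiv.coe_addRight]; abel

/-- The reflection exchanging the abscissas `0` and `c`. -/
def reflectX (c : ℤ) : LatticeSymm where
  onVertex := (Equiv.subLeft c).prodCongr (Equiv.refl ℤ)
  onEdge := (Equiv.subLeft (c + c)).prodCongr (Equiv.refl ℤ)
  adj_iff u v := by simp [squareLattice_adj]; omega
  map_add u v := by ext <;> simp; ring

/-- The reflection exchanging the ordinates `0` and `c`. -/
def reflectY (c : ℤ) : LatticeSymm where
  onVertex := (Equiv.refl ℤ).prodCongr (Equiv.subLeft c)
  onEdge := (Equiv.refl ℤ).prodCongr (Equiv.subLeft (c + c))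
  adj_iff u v := by simp [squareLattice_adj]; omega
  map_add u v := by ext <;> simp; ring

/-- The reflection exchanging the coordinates. -/
def swap : LatticeSymm where
  onVertex := Equiv.prodComm ℤ ℤ
  onEdge := Equiv.prodComm ℤ ℤ
  adj_iff u v := by simp [squareLattice_adj]; omega
  map_add u v := by ext <;> simp

variable (g : LatticeSymm)

lemma isOpenEdge_image {u v : ℤ × ℤ} :
    IsOpenEdge (g.onEdge '' ω) (g.onVertex u) (g.onVertex v) ↔ IsOpenEdge ω u v := by
  rw [IsOpenEdge, IsOpenEdge, g.adj_iff, g.map_add, g.onEdge.injective.mem_set_image]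

lemma edgesIn_image : edgesIn (g.onVertex '' D) = g.onEdge '' edgesIn D := by
  ext m
  constructor
  · rintro ⟨_, ⟨u, hu, rfl⟩, _, ⟨v, hv, rfl⟩, h, rfl⟩
    exact ⟨u + v, ⟨u, hu, v, hv, (g.adj_iff u v).1 h, rfl⟩, (g.map_add u v).symm⟩
  · rintro ⟨_, ⟨u, hu, v, hv, h, rfl⟩, rfl⟩
    exact ⟨_, ⟨u, hu, rfl⟩, _, ⟨v, hv, rfl⟩, (g.adj_iff u v).2 h, g.map_add u v⟩

lemma block_image : Block (g.onVertex '' D) (g.onVertex '' s) (g.onVertex '' t) (g.onEdge '' ω) ↔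
    Block D s t ω := by
  have inj := g.onVertex.injective
  constructor
  · rintro ⟨B, hBD, hs, ht, hB⟩
    refine ⟨g.onVertex ⁻¹' B, fun u hu => (inj.mem_set_image).1 (hBD hu),
      fun u hu hus => hs _ ⟨u, hu, rfl⟩ ⟨u, hus, rfl⟩, fun u hu hut => ht _ hu ⟨u, hut, rfl⟩,
      fun u hu v hv huv => hB _ hu _ ⟨v, hv, rfl⟩ (g.isOpenEdge_image.2 huv)⟩
  · rintro ⟨B, hBD, hs, ht, hB⟩
    refine ⟨g.onVertex '' B, Set.image_mono hBD, ?_, ?_, ?_⟩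
    · rintro _ ⟨u, hu, rfl⟩ hus
      exact ⟨u, hs u hu ((inj.mem_set_image).1 hus), rfl⟩
    · rintro _ ⟨u, hu, rfl⟩ hut
      exact ht u hu ((inj.mem_set_image).1 hut)
    · rintro _ ⟨u, hu, rfl⟩ _ ⟨v, hv, rfl⟩ huv
      exact ⟨v, hB u hu v hv (g.isOpenEdge_image.1 huv), rfl⟩

lemma pr_block_image (hD : D.Finite) :
    pr (Block (g.onVertex '' D) (g.onVertex '' s) (g.onVertex '' t)) = pr (Block D s t) := by
  have := pr_comp_image g.onEdge.toEmbedding (A := Block (g.onVertex '' D) (g.onVertex '' s)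
    (g.onVertex '' t)) (finite_edgesIn hD) (by
      rw [Equiv.coe_toEmbedding, ← g.edgesIn_image]; exact localOn_block)
  rw [← this]
  congr 1
  ext T
  exact g.block_image

lemma pr_comp {A : Set (ℤ × ℤ) → Prop} (hA : IsLocal A) :
    pr (fun ω => A (g.onEdge '' ω)) = pr A := by
  obtain ⟨F, hF⟩ := hA
  refine pr_comp_image g.onEdge.toEmbedding (E := g.onEdge ⁻¹' F)
    (F.finite_toSet.preimage g.onEdge.injective.injOn) ?_
  rwa [Equiv.coe_toEmbedding, Set.image_preimage_eq _ g.onEdge.surjective]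

end LatticeSymm

/-- The points of the rectangle `[a, b] × [c, d]`. -/
def rect (a b c d : ℤ) : Set (ℤ × ℤ) := {z | a ≤ z.1 ∧ z.1 ≤ b ∧ c ≤ z.2 ∧ z.2 ≤ d}

lemma mem_rect {a b c d : ℤ} {z : ℤ × ℤ} :
    z ∈ rect a b c d ↔ a ≤ z.1 ∧ z.1 ≤ b ∧ c ≤ z.2 ∧ z.2 ≤ d := Iff.rfl

lemma finite_rect (a b c d : ℤ) : (rect a b c d).Finite := by
  refine ((Set.finite_Icc a b).prod (Set.finite_Icc c d)).subset ?_
  rintro z ⟨h1, h2, h3, h4⟩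
  exact ⟨⟨h1, h2⟩, ⟨h3, h4⟩⟩

/-- No open path crosses the rectangle from left to right. -/
def BlockH (a b c d : ℤ) : Set (ℤ × ℤ) → Prop := Block (rect a b c d) {z | z.1 = a} {z | z.1 = b}

/-- No open path crosses the rectangle from bottom to top. -/
def BlockV (a b c d : ℤ) : Set (ℤ × ℤ) → Prop := Block (rect a b c d) {z | z.2 = c} {z | z.2 = d}

lemma isLocal_block_rect {a b c d : ℤ} : IsLocal (Block (rect a b c d) s t) :=
  localOn_block.isLocal (finite_edgesIn (finite_rect a b c d))

lemma isLocal_blockH {a b c d : ℤ} : IsLocal (BlockH a b c d) := isLocal_block_rect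

lemma isLocal_blockV {a b c d : ℤ} : IsLocal (BlockV a b c d) := isLocal_block_rect

lemma isLowerSet_blockH {a b c d : ℤ} : IsLowerSet {ω | BlockH a b c d ω} := isLowerSet_block

lemma isLowerSet_blockV {a b c d : ℤ} : IsLowerSet {ω | BlockV a b c d ω} := isLowerSet_block

lemma pr_blockV_swap (a b c d : ℤ) : pr (BlockV c d a b) = pr (BlockH a b c d) := by
  rw [BlockH, ← LatticeSymm.swap.pr_block_image (finite_rect a b c d), BlockV]
  congr 2 <;> ext z <;> rw [Set.mem_image_equiv]
  · simp [LatticeSymm.swap, rect]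
    tauto
  · simp [LatticeSymm.swap]
  · simp [LatticeSymm.swap]

lemma pr_blockH_add (a b c d x y : ℤ) :
    pr (BlockH (a + x) (b + x) (c + y) (d + y)) = pr (BlockH a b c d) := by
  rw [BlockH, BlockH,
    ← (LatticeSymm.translation (x, y)).pr_block_image (finite_rect a b c d)]
  congr 2 <;> ext z <;> rw [Set.mem_image_equiv] <;>
    simp [LatticeSymm.translation, rect] <;> omega

lemma pr_blockV_add (a b c d x y : ℤ) :
    pr (BlockV (a + x) (b + x) (c + y) (d + y)) = pr (BlockV a b c d) := by
  rw [pr_blockV_swap, pr_blockV_swap, pr_blockH_add]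

/-- The same certificate works: it stays strictly left of `b'`, so a single step from it cannot
leave the narrower rectangle on the right. -/
lemma blockH_mono_right {a b b' c d : ℤ} (hab : a ≤ b') (h : b' ≤ b) (hω : BlockH a b' c d ω) :
    BlockH a b c d ω := by
  obtain ⟨B, hBD, hs, ht, hB⟩ := hω
  have hlt : ∀ u ∈ B, u.1 < b' := fun u hu => by
    have h1 : ¬ u.1 = b' := ht u hu
    have h2 := hBD hu
    rw [mem_rect] at h2
    omega
  refine ⟨B, fun u hu => ?_, fun u hu hus => hs u ?_ hus, fun u hu hut => ?_,
    fun u hu v hv huv => hB u hu v ?_ huv⟩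
  · have := hBD hu
    rw [mem_rect] at *
    omega
  · have : u.1 = a := hus
    rw [mem_rect] at *
    omega
  · have h1 : u.1 = b := hut
    have := hlt u hu
    omega
  · have h1 := hlt u hu
    have h3 := squareLattice_adj.1 huv.1
    rw [mem_rect] at *
    omega

end Blocking

/-! ### Self-duality of the square lattice. -/

section Duality

/-- The lattice of half-edges: the doubled points of `D` and the open midpoints in `D`. -/
def doubled (D ω : Set (ℤ × ℤ)) : Set (ℤ × ℤ) :=
  {z | (∃ u ∈ D, u + u = z) ∨ (z ∈ ω ∧ z ∈ edgesIn D)}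

lemma linked_doubled {D s ω : Set (ℤ × ℤ)} {v : ℤ × ℤ} (h : v ∈ reach D s ω) :
    ∃ a ∈ D, a ∈ s ∧ Linked (doubled D ω) (a + a) (v + v) := by
  obtain ⟨a, ha, has, h⟩ := h
  refine ⟨a, ha, has, ?_⟩
  induction h with
  | refl => exact .refl (Or.inl ⟨a, ha, rfl⟩)
  | @tail y z hy h ih =>
    have hyD : y ∈ D := reach_subset ⟨a, ha, has, hy⟩
    have hm : y + z ∈ doubled D ω := Or.inr ⟨h.1.2, y, hyD, z, h.2, h.1.1, rfl⟩
    refine ih.trans ((Linked.of_adj ih.right_mem hm ?_).trans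
      (Linked.of_adj hm (Or.inl ⟨z, h.2, rfl⟩) ?_)) <;>
    · have := squareLattice_adj.1 h.1.1
      rw [squareLattice_adj]
      simp only [Prod.fst_add, Prod.snd_add]
      omega

/-- The duality between an edge and the dual edge crossing it, with the dual lattice identified
with the lattice by a reflection. -/
def dualEdge : (ℤ × ℤ) ≃ (ℤ × ℤ) where
  toFun m := (m.2 + 1, m.1 - 1)
  invFun m := (m.2 + 1, m.1 - 1)
  left_inv m := by simp
  right_inv m := by simp

lemma dualEdge_apply (m : ℤ × ℤ) : dualEdge m = (m.2 + 1, m.1 - 1) := rfl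

lemma dualEdge_dualEdge (m : ℤ × ℤ) : dualEdge (dualEdge m) = m := dualEdge.left_inv m

/-- Were both rectangles crossed, `dualEdge` would turn the second crossing into a vertical one, and
in the doubled lattice it would meet the first. A meeting point would be the midpoint of an edge
both open and closed. -/
lemma blockH_or_blockH_dual {n : ℤ} (ω : Set (ℤ × ℤ)) :
    BlockH 0 (n + 1) 0 n ω ∨ BlockH 0 (n + 1) 0 n (dualEdge '' ωᶜ) := by
  by_contra! h
  obtain ⟨h, h'⟩ := h
  rw [BlockH, block_iff_reach] at h h'
  push Not at h h'
  obtain ⟨v, hv, hv1⟩ := h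
  obtain ⟨v', hv', hv1'⟩ := h'
  obtain ⟨a, ha, ha1, hl⟩ := linked_doubled hv
  obtain ⟨a', ha', ha1', hl'⟩ := linked_doubled hv'
  have hl'' := hl'.image dualEdge (fun u v h => by
    rw [squareLattice_adj] at *
    simp only [dualEdge_apply]
    omega)
  have e1 : v.1 = n + 1 := hv1
  have e2 : v'.1 = n + 1 := hv1'
  have e3 : a.1 = 0 := ha1
  have e4 : a'.1 = 0 := ha1'
  have bd : ∀ ω : Set (ℤ × ℤ), ∀ z ∈ doubled (rect 0 (n + 1) 0 n) ω,
      0 ≤ z.1 ∧ z.1 ≤ 2 * n + 2 ∧ 0 ≤ z.2 ∧ z.2 ≤ 2 * n := by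
    rintro ω z (⟨u, hu, rfl⟩ | ⟨-, u, hu, v, hv, -, rfl⟩)
    · rw [mem_rect] at hu
      simp only [Prod.fst_add, Prod.snd_add]
      omega
    · rw [mem_rect] at hu hv
      simp only [Prod.fst_add, Prod.snd_add]
      omega
  obtain ⟨z, ⟨z', hz', hzz⟩, hz⟩ := inter_nonempty_of_linked (x₀ := 0) (x₁ := 2 * n + 2)
    (y₀ := -1) (y₁ := 2 * n + 1)
    (by
      rintro _ ⟨z, hz, rfl⟩
      have := bd _ z hz
      simp only [dualEdge_apply]
      omega)
    (fun z hz => by have := bd _ z hz; omega) hl'' hl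
    (by simp only [dualEdge_apply, Prod.fst_add]; omega)
    (by simp only [dualEdge_apply, Prod.fst_add]; omega)
    (by simp only [Prod.fst_add]; omega) (by simp only [Prod.fst_add]; omega)
  -- Midpoints have odd coordinate sum, doubled vertices have two even coordinates and their
  -- `dualEdge` images two odd ones. Two crossings can therefore only meet at midpoints.
  have o : ∀ u v : ℤ × ℤ, squareLattice.Adj u v → ((u + v).1 + (u + v).2) % 2 = 1 := by
    intro u v h
    rw [squareLattice_adj] at h
    simp only [Prod.fst_add, Prod.snd_add]
    omega
  rw [dualEdge_apply, Prod.ext_iff] at hzz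
  simp only at hzz
  rcases hz with ⟨u, -, rfl⟩ | ⟨hzω, w, -, w', -, hw, rfl⟩
  · rcases hz' with ⟨u', -, rfl⟩ | ⟨-, w, -, w', -, hw, rfl⟩
    · simp only [Prod.fst_add, Prod.snd_add] at hzz
      omega
    · have := o _ _ hw
      simp only [Prod.fst_add, Prod.snd_add] at hzz this
      omega
  · rcases hz' with ⟨u', -, rfl⟩ | ⟨⟨m, hm, rfl⟩, -⟩
    · have := o _ _ hw
      simp only [Prod.fst_add, Prod.snd_add] at hzz this
      omega
    · refine hm ?_
      convert hzω
      rw [← dualEdge_dualEdge m, dualEdge_apply (dualEdge m)]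
      exact Prod.ext hzz.1 hzz.2

/-- Edges inside the left column join points already in the certificate, and edges inside the right
column start outside of it. The remaining midpoints lie in a rectangle that `dualEdge` preserves. -/
lemma localOn_blockH (n : ℤ) :
    LocalOn (rect 1 (2 * n + 1) 0 (2 * n)) (BlockH 0 (n + 1) 0 n) := by
  have : ∀ ω ω' : Set (ℤ × ℤ), ω ∩ rect 1 (2 * n + 1) 0 (2 * n) =
      ω' ∩ rect 1 (2 * n + 1) 0 (2 * n) →
      BlockH 0 (n + 1) 0 n ω → BlockH 0 (n + 1) 0 n ω' := by
    rintro ω ω' h ⟨B, hBD, hs, ht, hB⟩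
    refine ⟨B, hBD, hs, ht, fun u hu v hv huv => ?_⟩
    by_cases hv0 : v.1 = 0
    · exact hs v hv hv0
    · refine hB u hu v hv ⟨huv.1, (h.superset ⟨huv.2, ?_⟩).1⟩
      have h1 : ¬ u.1 = n + 1 := ht u hu
      have h2 := hBD hu
      have h3 := squareLattice_adj.1 huv.1
      rw [mem_rect] at *
      simp only [Prod.fst_add, Prod.snd_add]
      omega
  exact fun ω ω' h => ⟨this ω ω' h, this ω' ω h.symm⟩

lemma pr_comp_compl {ι : Type*} {A : Set ι → Prop} (hA : IsLocal A) :
    pr (fun T => A Tᶜ) = pr A := by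
  classical
  obtain ⟨F, hF⟩ := hA
  have hF' : LocalOn (F : Set ι) fun T => A Tᶜ := fun T T' h => hF _ _ (by
    ext e
    have := Set.ext_iff.1 h e
    simp only [Set.mem_inter_iff, Set.mem_compl_iff] at this ⊢
    tauto)
  rw [pr_eq hF, pr_eq hF', prob, prob, avg, avg]
  congr 1
  refine Finset.sum_bij' (fun T _ => F \ T) (fun T _ => F \ T) ?_ ?_ ?_ ?_ ?_
  · simp
  · simp
  · intro T hT
    simpa using hT
  · intro T hT
    simpa using hT
  · intro T hT
    have : A (Tᶜ : Set ι) ↔ A ((F \ T : Finset ι) : Set ι) := hF _ _ (by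
      ext e
      simp +contextual)
    simp only [this]

/-- Complementation and `dualEdge` preserve fair percolation, so the two alternatives of
`blockH_or_blockH_dual` have the same probability. -/
lemma half_le_pr_blockH_square (n : ℤ) :
    1 / 2 ≤ pr (BlockH 0 (n + 1) 0 n) := by
  have hl := localOn_blockH n
  set A := BlockH 0 (n + 1) 0 n with hA
  set R := rect 1 (2 * n + 1) 0 (2 * n) with hR
  have hRi : dualEdge '' R = R := by
    ext z
    rw [Set.mem_image_equiv]
    change (z.2 + 1, z.1 - 1) ∈ R ↔ _
    rw [hR, mem_rect, mem_rect]
    simp only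
    omega
  have hfin : R.Finite := finite_rect _ _ _ _
  have hl1 : LocalOn R fun ω => A (dualEdge '' ω) := fun T T' h => hl _ _ (by
    rw [← hRi, ← Set.image_inter dualEdge.injective, ← Set.image_inter dualEdge.injective, h])
  have hl2 : LocalOn R fun ω => A (dualEdge '' ωᶜ) := fun T T' h => hl1 _ _ (by
    ext e
    have := Set.ext_iff.1 h e
    simp only [Set.mem_inter_iff, Set.mem_compl_iff] at this ⊢
    tauto)
  have e2 : pr (fun ω => A (dualEdge '' ω)) = pr A :=
    pr_comp_image dualEdge.toEmbedding hfin (by rwa [Equiv.coe_toEmbedding, hRi])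
  have e3 : pr (fun ω => A (dualEdge '' ωᶜ)) = pr A :=
    (pr_comp_compl (hl1.isLocal hfin)).trans e2
  have h1 := pr_mono (hl.not.isLocal hfin) (hl2.isLocal hfin)
    fun ω h => (blockH_or_blockH_dual ω).resolve_left h
  rw [pr_not (hl.isLocal hfin), e3] at h1
  linarith

lemma half_le_pr_blockH {a b c d : ℤ} (hcd : c ≤ d) (h : d - c + 1 ≤ b - a) :
    1 / 2 ≤ pr (BlockH a b c d) := by
  have e := pr_blockH_add 0 (d - c + 1) 0 (d - c) a c
  refine (half_le_pr_blockH_square (d - c)).trans ?_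
  rw [← e, zero_add, zero_add, sub_add_cancel]
  exact pr_mono isLocal_blockH isLocal_blockH
    fun ω => blockH_mono_right (by omega) (by omega)

lemma half_le_pr_blockV {a b c d : ℤ} (hab : a ≤ b) (h : b - a + 1 ≤ d - c) :
    1 / 2 ≤ pr (BlockV a b c d) := by
  rw [pr_blockV_swap]
  exact half_le_pr_blockH hab h

end Duality

/-! ### The Russo–Seymour–Welsh reflection argument. -/

section RussoSeymourWelsh

lemma Block.mono_domain {D D' s t ω : Set (ℤ × ℤ)} (h : Block D s t ω) (hD : D' ⊆ D) :
    Block D' s t ω := by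
  obtain ⟨B, -, hs, ht, hB⟩ := h
  exact ⟨B ∩ D', Set.inter_subset_right, fun u hu hus => ⟨hs u (hD hu) hus, hu⟩,
    fun u hu => ht u hu.1, fun u hu v hv huv => ⟨hB u hu.1 v (hD hv) huv, hv⟩⟩

lemma reach_mono {D D' s ω : Set (ℤ × ℤ)} (hD : D' ⊆ D) : reach D' s ω ⊆ reach D s ω := by
  rintro v ⟨a, ha, has, h⟩
  exact ⟨a, hD ha, has, Relation.ReflTransGen.mono (fun _ _ h => ⟨h.1, hD h.2⟩) _ _ h⟩

lemma eq_or_eq_of_add_eq {u v u' v' : ℤ × ℤ} (h : squareLattice.Adj u v)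
    (h' : squareLattice.Adj u' v') (e : u + v = u' + v') :
    (u = u' ∧ v = v') ∨ (u = v' ∧ v = u') := by
  rw [squareLattice_adj] at h h'
  simp only [Prod.ext_iff, Prod.fst_add, Prod.snd_add] at *
  omega

lemma disjoint_edgesIn {D D' : Set (ℤ × ℤ)} (h : Disjoint D D') :
    Disjoint (edgesIn D) (edgesIn D') := by
  rw [Set.disjoint_left] at *
  rintro _ ⟨u, hu, v, hv, huv, rfl⟩ ⟨u', hu', v', hv', huv', e⟩
  rcases eq_or_eq_of_add_eq huv huv' e.symm with ⟨rfl, rfl⟩ | ⟨rfl, rfl⟩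
  · exact h hu hu'
  · exact h hu hv'

/-- The points of `[0, 2h] × [0, 2h + 1]` outside of `A` and of its image under the reflection
exchanging the lower and the upper half. -/
def outside (h : ℤ) (A : Set (ℤ × ℤ)) : Set (ℤ × ℤ) :=
  {z | z ∈ rect 0 (2 * h) 0 (2 * h + 1) ∧ z ∉ A ∧ (z.1, 2 * h + 1 - z.2) ∉ A}

/-- No open path outside of `A` and its reflection joins the bottom to the top or to the
reflection of `A`. -/
def BlockBelow (h : ℤ) (A : Set (ℤ × ℤ)) : Set (ℤ × ℤ) → Prop :=
  Block (outside h A) {z | z.2 = 0} {z | z.2 = 2 * h + 1 ∨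
    ∃ w, (w.1, 2 * h + 1 - w.2) ∈ A ∧ squareLattice.Adj z w}

/-- No open path outside of `A` and its reflection joins the top to the bottom or to `A`. -/
def BlockAbove (h : ℤ) (A : Set (ℤ × ℤ)) : Set (ℤ × ℤ) → Prop :=
  Block (outside h A) {z | z.2 = 2 * h + 1} {z | z.2 = 0 ∨ ∃ w ∈ A, squareLattice.Adj z w}

lemma outside_subset {h : ℤ} {A : Set (ℤ × ℤ)} : outside h A ⊆ rect 0 (2 * h) 0 (2 * h + 1) :=
  fun _ hz => hz.1

lemma finite_outside {h : ℤ} {A : Set (ℤ × ℤ)} : (outside h A).Finite :=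
  (finite_rect _ _ _ _).subset outside_subset

lemma pr_blockAbove (h : ℤ) (A : Set (ℤ × ℤ)) : pr (BlockAbove h A) = pr (BlockBelow h A) := by
  rw [BlockAbove, ← (LatticeSymm.reflectY (2 * h + 1)).pr_block_image finite_outside, BlockBelow]
  have hg : ∀ z, (LatticeSymm.reflectY (2 * h + 1)).onVertex.symm z = (z.1, 2 * h + 1 - z.2) := by
    intro z
    ext <;> simp [LatticeSymm.reflectY, Equiv.subLeft]
    ring
  congr 2 <;> ext z <;> rw [Set.mem_image_equiv, hg]
  · simp only [outside, Set.mem_ofPred_eq, mem_rect, sub_sub_cancel]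
    constructor <;> rintro ⟨h1, h2, h3⟩ <;> exact ⟨by omega, h3, h2⟩
  · simp only [Set.mem_ofPred_eq]
    omega
  · simp only [Set.mem_ofPred_eq]
    refine or_congr (by omega) ⟨?_, ?_⟩
    · rintro ⟨w, hw, hzw⟩
      refine ⟨(w.1, 2 * h + 1 - w.2), by simpa using hw, ?_⟩
      rw [squareLattice_adj] at *
      simp only at *
      omega
    · rintro ⟨w, hw, hzw⟩
      refine ⟨(w.1, 2 * h + 1 - w.2), by simpa using hw, ?_⟩
      rw [squareLattice_adj] at *
      simp only at *
      omega

/-- The cluster of the left side of `[0, h + 1] × [0, h]`. -/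
def leftCluster (h : ℤ) (ω : Set (ℤ × ℤ)) : Set (ℤ × ℤ) :=
  reach (rect 0 (h + 1) 0 h) {z | z.1 = 0} ω

/-- If both fail, an open path leads from the bottom to the reflection of `A`, and another from the
top to `A`. Since `A` meets the left side below its reflection, planarity makes these paths meet,
and together they cross from bottom to top. -/
lemma blockBelow_or_blockAbove {h : ℤ} (hh : 1 ≤ h) {ω₀ ω : Set (ℤ × ℤ)}
    (hω : BlockV 0 (2 * h) 0 (2 * h + 1) ω) :
    BlockBelow h (leftCluster h ω₀) ω ∨ BlockAbove h (leftCluster h ω₀) ω := by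
  set A := leftCluster h ω₀ with hA
  have hAS : ∀ z ∈ A, z ∈ rect 0 (h + 1) 0 h := fun z hz => reach_subset hz
  by_contra! hcon
  obtain ⟨h1, h2⟩ := hcon
  rw [BlockBelow, block_iff_reach] at h1
  rw [BlockAbove, block_iff_reach] at h2
  rw [BlockV, block_iff_reach] at hω
  push Not at h1 h2
  obtain ⟨u, hu, hut⟩ := h1
  obtain ⟨v, hv, hvt⟩ := h2
  have closedBelow := fun x hx y hy => mem_reach_of_open (D := outside h A) (s := {z | z.2 = 0})
    (ω := ω) (u := x) (v := y) hx hy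
  rcases hut with hut | ⟨w, hw, huw⟩
  · exact hω u (reach_mono outside_subset hu) hut
  rcases hvt with hvt | ⟨w', hw', hvw'⟩
  · obtain ⟨b, -, hb, hb'⟩ :=
      exists_mem_of_mem_reach (mem_reach_of_mem (reach_subset hv) hvt) hv closedBelow
    exact hω b (reach_mono outside_subset hb') hb
  obtain ⟨c, -, hc, hcu⟩ := linked_of_mem_reach hu
  obtain ⟨d, -, hd, hdv⟩ := linked_of_mem_reach hv
  obtain ⟨a, haS, ha0, haw⟩ := linked_of_mem_reach hw
  obtain ⟨b, hbS, hb0, hbw⟩ := linked_of_mem_reach hw'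
  obtain ⟨c1, c2⟩ := c
  obtain ⟨d1, d2⟩ := d
  obtain ⟨a1, a2⟩ := a
  obtain ⟨b1, b2⟩ := b
  have e1 : c2 = 0 := hc
  have e2 : d2 = 2 * h + 1 := hd
  have e3 : a1 = 0 := ha0
  have e4 : b1 = 0 := hb0
  subst e1 e2 e3 e4
  have haw' := haw.image (fun z => (z.1, 2 * h + 1 - z.2)) (fun u v h => by
    rw [squareLattice_adj] at *
    simp only at *
    omega)
  simp only [sub_sub_cancel] at haw'
  rw [mem_rect] at haS hbS
  simp only at haS hbS
  obtain ⟨z, hz', hz⟩ := inter_nonempty_of_linked_left (m := 2 * h) (n := 2 * h + 1)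
    (a := 2 * h + 1 - a2) (b := b2)
    (K := (fun z : ℤ × ℤ => (z.1, 2 * h + 1 - z.2)) '' A ∪ reach (outside h A) {z | z.2 = 0} ω)
    (K' := reach (outside h A) {z | z.2 = 2 * h + 1} ω ∪ A)
    (by
      rintro z (⟨z, hz, rfl⟩ | hz)
      · have := hAS z hz
        rw [mem_rect] at this
        simp only
        omega
      · exact outside_subset (reach_subset hz))
    (by
      rintro z (hz | hz)
      · exact outside_subset (reach_subset hz)
      · have := hAS z hz
        rw [mem_rect] at this
        omega)
    ((haw'.mono Set.subset_union_left).trans ((Linked.of_adj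
      (Or.inl haw'.right_mem) (Or.inr hu) huw.symm).trans
        (hcu.symm.mono Set.subset_union_right)))
    ((hdv.mono Set.subset_union_left).trans ((Linked.of_adj (Or.inl hv) (Or.inr hw') hvw').trans
      (hbw.symm.mono Set.subset_union_right)))
    (by omega)
  -- `A`, its reflection and `outside h A` are disjoint, so only the two open paths can share a
  -- point.
  rcases hz' with hz' | hz'
  · rcases hz with ⟨z, hz, rfl⟩ | hz
    · exact (reach_subset hz').2.2 (by simpa using hz)
    · obtain ⟨b, -, hb, hb'⟩ := exists_mem_of_mem_reach hz hz' closedBelow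
      exact hω b (reach_mono outside_subset hb') hb
  · rcases hz with ⟨z, hz, rfl⟩ | hz
    · have h1 := hAS _ hz
      have h2 := hAS _ hz'
      rw [mem_rect] at h1 h2
      simp only at h1 h2
      omega
    · exact (reach_subset hz).2.1 hz'

/-- The two alternatives of `blockBelow_or_blockAbove` are mirror images, and together they have
probability at least 1/2. -/
lemma quarter_le_pr_blockBelow {h : ℤ} (hh : 1 ≤ h) (ω₀ : Set (ℤ × ℤ)) :
    1 / 4 ≤ pr (BlockBelow h (leftCluster h ω₀)) := by
  have h1 : 1 / 2 ≤ pr (BlockV 0 (2 * h) 0 (2 * h + 1)) :=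
    half_le_pr_blockV (by omega) (by omega)
  have h2 := pr_le_add isLocal_blockV (localOn_block.isLocal (finite_edgesIn finite_outside))
    (localOn_block.isLocal (finite_edgesIn finite_outside))
    fun ω => blockBelow_or_blockAbove hh (ω₀ := ω₀) (ω := ω)
  have h3 := pr_blockAbove h (leftCluster h ω₀)
  rw [BlockBelow, BlockAbove] at *
  linarith

/-- The edges of `[0, h + 1] × [0, h]` with an endpoint in `A`. -/
def exploredEdges (h : ℤ) (A : Set (ℤ × ℤ)) : Set (ℤ × ℤ) :=
  {m | ∃ u ∈ A, ∃ v ∈ rect 0 (h + 1) 0 h, u ∈ rect 0 (h + 1) 0 h ∧ squareLattice.Adj u v ∧ u + v = m}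

/-- Exploring a cluster only examines edges touching it. Conditioning on the cluster therefore
leaves the edges in `outside h A` fresh. -/
lemma localOn_leftCluster (h : ℤ) (A : Set (ℤ × ℤ)) :
    LocalOn (exploredEdges h A) fun ω => leftCluster h ω = A := by
  have : ∀ ω ω' : Set (ℤ × ℤ), ω ∩ exploredEdges h A = ω' ∩ exploredEdges h A →
      leftCluster h ω = A → leftCluster h ω' = A := by
    intro ω ω' hωω hA
    have hAS : ∀ z ∈ A, z ∈ rect 0 (h + 1) 0 h := fun z hz => reach_subset (hA.superset hz)
    refine subset_antisymm ?_ ?_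
    · rintro v ⟨a, ha, has, hav⟩
      induction hav with
      | refl => exact hA.subset (mem_reach_of_mem ha has)
      | @tail y z _ hyz ih =>
        refine hA.subset (mem_reach_of_open (hA.superset ih) hyz.2 ⟨hyz.1.1, ?_⟩)
        exact (hωω.superset ⟨hyz.1.2, y, ih, z, hyz.2, hAS y ih, hyz.1.1, rfl⟩).1
    · intro v hv
      obtain ⟨a, ha, has, hav⟩ := hA.superset hv
      clear hv
      refine ⟨a, ha, has, ?_⟩
      induction hav with
      | refl => exact .refl
      | @tail y z hy hyz ih =>
        have hyA : y ∈ A := hA.subset ⟨a, ha, has, hy⟩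
        refine ih.tail ⟨⟨hyz.1.1, ?_⟩, hyz.2⟩
        exact (hωω.subset ⟨hyz.1.2, y, hyA, z, hyz.2, hAS y hyA, hyz.1.1, rfl⟩).1
  exact fun ω ω' h => ⟨this ω ω' h, this ω' ω h.symm⟩

lemma exploredEdges_subset (h : ℤ) (A : Set (ℤ × ℤ)) :
    exploredEdges h A ⊆ edgesIn (rect 0 (h + 1) 0 h) := by
  rintro m ⟨u, -, v, hv, hu, huv, rfl⟩
  exact ⟨u, hu, v, hv, huv, rfl⟩

lemma disjoint_exploredEdges (h : ℤ) (A : Set (ℤ × ℤ)) :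
    Disjoint (exploredEdges h A) (edgesIn (outside h A)) := by
  rw [Set.disjoint_left]
  rintro _ ⟨u, hu, v, -, -, huv, rfl⟩ ⟨u', hu', v', hv', huv', e⟩
  rcases eq_or_eq_of_add_eq huv huv' e.symm with ⟨rfl, rfl⟩ | ⟨rfl, rfl⟩
  · exact hu'.2.1 hu
  · exact hv'.2.1 hu

/-- A closed set `A` separates the left and right sides of `[0, h + 1] × [0, h]`, and no open
path of `[0, 2h] × [0, 2h + 1]` joins the bottom outside of `A` to the top, to `A` or to its
reflection. -/
def Hook (h : ℤ) (ω : Set (ℤ × ℤ)) : Prop :=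
  ∃ A B : Set (ℤ × ℤ), A ⊆ rect 0 (h + 1) 0 h ∧
    (∀ u ∈ rect 0 (h + 1) 0 h, u.1 = 0 → u ∈ A) ∧ (∀ u ∈ A, u.1 ≠ h + 1) ∧
    (∀ u ∈ A, ∀ v ∈ rect 0 (h + 1) 0 h, IsOpenEdge ω u v → v ∈ A) ∧
    B ⊆ outside h A ∧
    (∀ u ∈ rect 0 (2 * h) 0 (2 * h + 1), u.2 = 0 → u ∉ A → u ∈ B) ∧
    (∀ u ∈ B, u.2 ≠ 2 * h + 1) ∧
    (∀ u ∈ B, ∀ v ∈ rect 0 (2 * h) 0 (2 * h + 1), IsOpenEdge ω u v → v ∈ B)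

lemma isLowerSet_hook (h : ℤ) : IsLowerSet {ω | Hook h ω} := by
  rintro ω ω' hω ⟨A, B, h1, h2, h3, h4, h5, h6, h7, h8⟩
  exact ⟨A, B, h1, h2, h3, fun u hu v hv huv => h4 u hu v hv (huv.mono hω), h5, h6, h7,
    fun u hu v hv huv => h8 u hu v hv (huv.mono hω)⟩

lemma isLocal_hook {h : ℤ} (hh : 1 ≤ h) : IsLocal (Hook h) := by
  have hsub : rect 0 (h + 1) 0 h ⊆ rect 0 (2 * h) 0 (2 * h + 1) := fun z hz => by
    rw [mem_rect] at *
    omega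
  have : ∀ ω ω' : Set (ℤ × ℤ), ω ∩ edgesIn (rect 0 (2 * h) 0 (2 * h + 1)) =
      ω' ∩ edgesIn (rect 0 (2 * h) 0 (2 * h + 1)) → Hook h ω → Hook h ω' := by
    rintro ω ω' hω ⟨A, B, h1, h2, h3, h4, h5, h6, h7, h8⟩
    exact ⟨A, B, h1, h2, h3, fun u hu v hv huv => h4 u hu v hv
      ((isOpenEdge_iff_of_inter hω (hsub (h1 hu)) (hsub hv)).2 huv), h5, h6, h7,
      fun u hu v hv huv => h8 u hu v hv ((isOpenEdge_iff_of_inter hω (h5 hu).1 hv).2 huv)⟩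
  exact LocalOn.isLocal (fun ω ω' h => ⟨this ω ω' h, this ω' ω h.symm⟩)
    (finite_edgesIn (finite_rect 0 (2 * h) 0 (2 * h + 1)))

lemma hook_of_blockBelow {h : ℤ} {ω : Set (ℤ × ℤ)}
    (hC : ∀ u ∈ leftCluster h ω, u.1 ≠ h + 1) (hω : BlockBelow h (leftCluster h ω) ω) :
    Hook h ω := by
  obtain ⟨B, hB1, hB2, hB3, hB4⟩ := hω
  set A := leftCluster h ω with hA
  have hAS : ∀ z ∈ A, z ∈ rect 0 (h + 1) 0 h := fun z hz => reach_subset hz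
  refine ⟨A, B, hAS, fun u hu hu0 => mem_reach_of_mem hu hu0, hC,
    fun u hu v hv huv => mem_reach_of_open hu hv huv, hB1, ?_, ?_, ?_⟩
  · intro u hu hu0 huA
    refine hB2 u ⟨hu, huA, fun hA' => ?_⟩ hu0
    have := hAS _ hA'
    rw [mem_rect] at hu this
    simp only at this
    omega
  · exact fun u hu hu' => hB3 u hu (Or.inl hu')
  · intro u hu v hv huv
    have hu' := hB1 hu
    refine hB4 u hu v ⟨hv, fun hvA => ?_, fun hvA => ?_⟩ huv
    -- An open step from `B` into `A` is impossible: inside the small rectangle `A` is closed under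
    -- open steps, and a neighbour of `A` outside it lies just above, at the mirror image of its
    -- neighbour, which `outside` excludes.
    · by_cases huS : u ∈ rect 0 (h + 1) 0 h
      · exact hu'.2.1 (mem_reach_of_open hvA huS huv.symm)
      · have h1 := hC v hvA
        have h2 := hAS v hvA
        have h3 := squareLattice_adj.1 huv.1
        have h4 := hu'.1
        refine hu'.2.2 ?_
        rw [mem_rect] at huS h2 h4
        convert hvA using 1
        ext <;> simp only <;> omega
    · exact hB3 u hu (Or.inr ⟨v, hvA, huv.1⟩)

lemma eighth_le_pr_hook {h : ℤ} (hh : 1 ≤ h) : 1 / 8 ≤ pr (Hook h) := by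
  classical
  have hfin : {A | A ⊆ rect 0 (h + 1) 0 h ∧ (∃ ω₀, leftCluster h ω₀ = A) ∧
      ∀ u ∈ A, u.1 ≠ h + 1}.Finite :=
    (finite_rect 0 (h + 1) 0 h).finite_subsets.subset fun A hA => hA.1
  set s := hfin.toFinset with hs
  have hmem : ∀ A, A ∈ s ↔ A ⊆ rect 0 (h + 1) 0 h ∧ (∃ ω₀, leftCluster h ω₀ = A) ∧
      ∀ u ∈ A, u.1 ≠ h + 1 := fun A => by
    rw [hs, Set.Finite.mem_toFinset]
    rfl
  have e : (fun ω => leftCluster h ω ∈ s) = BlockH 0 (h + 1) 0 h := by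
    ext ω
    rw [hmem, BlockH, block_iff_reach]
    exact ⟨fun h u hu => h.2.2 u hu, fun h => ⟨reach_subset, ⟨ω, rfl⟩, h⟩⟩
  have hf : ∀ A, (exploredEdges h A).Finite := fun A =>
    (finite_edgesIn (finite_rect _ _ _ _)).subset (exploredEdges_subset h A)
  -- Decomposition over the values of the left cluster that miss the right side, an event of
  -- probability at least 1/2; hence 1/8 = 1/4 · 1/2.
  have key := mul_pr_le_pr_of_indep (leftCluster h) s (BlockBelow h) (A := Hook h) (1 / 4)
    (fun A _ => (localOn_leftCluster h A).isLocal (hf A))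
    (fun A _ => localOn_block.isLocal (finite_edgesIn finite_outside))
    (fun A _ => pr_and_of_disjoint (localOn_leftCluster h A) localOn_block (hf A)
      (finite_edgesIn finite_outside) (disjoint_exploredEdges h A))
    (fun A hA => by
      obtain ⟨-, ⟨ω₀, rfl⟩, -⟩ := (hmem A).1 hA
      exact quarter_le_pr_blockBelow hh ω₀)
    (isLocal_hook hh) (by rw [e]; exact isLocal_blockH)
    (by
      rintro ω A hA rfl hω
      exact hook_of_blockBelow ((hmem _).1 hA).2.2 hω)
  rw [e] at key
  have := half_le_pr_blockH (a := 0) (b := h + 1) (c := 0) (d := h) (by omega) (by omega)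
  linarith

end RussoSeymourWelsh

/-! ### Long blocked rectangles, blocked annuli and the decay of connections. -/

section Annuli

lemma isLowerSet_comp_image {ι κ : Type*} {A : Set ι → Prop} (hA : IsLowerSet {ω | A ω})
    (g : κ → ι) : IsLowerSet {ω : Set κ | A (g '' ω)} :=
  fun _ _ h hω => hA (Set.image_mono h) hω

lemma isLowerSet_and {ι : Type*} {A B : Set ι → Prop} (hA : IsLowerSet {ω | A ω})
    (hB : IsLowerSet {ω | B ω}) : IsLowerSet {ω | A ω ∧ B ω} :=
  fun _ _ h hω => ⟨hA h hω.1, hB h hω.2⟩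

lemma IsLocal.comp_image {A : Set (ℤ × ℤ) → Prop} (hA : IsLocal A)
    (g : (ℤ × ℤ) ≃ (ℤ × ℤ)) : IsLocal fun ω => A (g '' ω) := by
  obtain ⟨F, hF⟩ := hA
  refine LocalOn.isLocal (E := g ⁻¹' F) (fun T T' h => hF _ _ ?_)
    (F.finite_toSet.preimage g.injective.injOn)
  rw [← Set.image_preimage_eq (F : Set (ℤ × ℤ)) g.surjective, ← Set.image_inter g.injective,
    ← Set.image_inter g.injective, h]

lemma hook_reflect {h : ℤ} {ω : Set (ℤ × ℤ)}
    (hω : Hook h ((LatticeSymm.reflectX (h + 1)).onEdge '' ω)) :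
    ∃ A B : Set (ℤ × ℤ), A ⊆ rect 0 (h + 1) 0 h ∧
    (∀ u ∈ rect 0 (h + 1) 0 h, u.1 = h + 1 → u ∈ A) ∧ (∀ u ∈ A, u.1 ≠ 0) ∧
    (∀ u ∈ A, ∀ v ∈ rect 0 (h + 1) 0 h, IsOpenEdge ω u v → v ∈ A) ∧
    B ⊆ rect (1 - h) (h + 1) 0 (2 * h + 1) ∧
    (∀ u ∈ B, u ∉ A ∧ (u.1, 2 * h + 1 - u.2) ∉ A) ∧
    (∀ u ∈ rect (1 - h) (h + 1) 0 (2 * h + 1), u.2 = 0 → u ∉ A → u ∈ B) ∧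
    (∀ u ∈ B, u.2 ≠ 2 * h + 1) ∧
    (∀ u ∈ B, ∀ v ∈ rect (1 - h) (h + 1) 0 (2 * h + 1), IsOpenEdge ω u v → v ∈ B) := by
  obtain ⟨A, B, h1, h2, h3, h4, h5, h6, h7, h8⟩ := hω
  have ho : ∀ u v, IsOpenEdge ω u v → IsOpenEdge ((LatticeSymm.reflectX (h + 1)).onEdge '' ω)
      (h + 1 - u.1, u.2) (h + 1 - v.1, v.2) :=
    fun u v huv => ((LatticeSymm.reflectX (h + 1)).isOpenEdge_image).2 huv
  refine ⟨{u | (h + 1 - u.1, u.2) ∈ A}, {u | (h + 1 - u.1, u.2) ∈ B}, fun u hu => ?_,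
    fun u hu hu' => h2 _ ?_ ?_, fun u hu hu' => h3 _ hu ?_,
    fun u hu v hv huv => h4 _ hu _ ?_ (ho u v huv), fun u hu => ?_, fun u hu => (h5 hu).2,
    fun u hu hu' huA => h6 _ ?_ hu' huA, fun u hu => h7 (h + 1 - u.1, u.2) hu,
    fun u hu v hv huv => h8 _ hu _ ?_ (ho u v huv)⟩
  · have := h1 hu
    rw [mem_rect] at *
    simp only at *
    omega
  · rw [mem_rect] at *
    simp only at *
    omega
  · simp only
    omega
  · simp only
    omega
  · rw [mem_rect] at *
    simp only at *
    omega
  · have := (h5 hu).1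
    rw [mem_rect] at *
    simp only at *
    omega
  · rw [mem_rect] at *
    simp only at *
    omega
  · rw [mem_rect] at *
    simp only at *
    omega

/-- In dual terms, one hook reaches the right side, its mirror image reaches the left side, and the
blocked square `[1, h] × [0, h]` joins the two. -/
lemma blockV_of_hook {h : ℤ} (hh : 1 ≤ h) {ω : Set (ℤ × ℤ)} (h₁ : Hook h ω)
    (h₂ : Hook h ((LatticeSymm.reflectX (h + 1)).onEdge '' ω)) (h₃ : BlockV 1 h 0 h ω) :
    BlockV (1 - h) (2 * h) 0 (2 * h + 1) ω := by
  obtain ⟨A, B, a1, a2, a3, a4, b1, b2, b3, b4⟩ := h₁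
  obtain ⟨A', B', a1', a2', a3', a4', b0', b1', b2', b3', b4'⟩ := hook_reflect h₂
  obtain ⟨T, t1, t2, t3, t4⟩ := h₃
  have hb1 : ∀ u ∈ B, u ∈ rect 0 (2 * h) 0 (2 * h + 1) := fun u hu => (b1 hu).1
  -- `B` takes care of the bottom points outside `A`, `B'` of those outside `A'`, and `T` of those
  -- in both. A point of `T` lies below height `h`, so its open neighbours stay in `A` and `A'`,
  -- hence in the columns from `1` to `h`.
  refine ⟨B ∪ B' ∪ (T ∩ (A ∩ A')), ?_, ?_, ?_, ?_⟩
  · rintro u ((hu | hu) | ⟨hu, -⟩)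
    · have := hb1 u hu
      rw [mem_rect] at *
      omega
    · have := b0' hu
      rw [mem_rect] at *
      omega
    · have := t1 hu
      rw [mem_rect] at *
      omega
  · intro u hu hu0
    have hu0' : u.2 = 0 := hu0
    by_cases huA : u ∈ A
    · by_cases huA' : u ∈ A'
      · refine Or.inr ⟨t2 u ?_ hu0, huA, huA'⟩
        have h1 := a1 huA
        have h2 := a3 u huA
        have h3 := a3' u huA'
        rw [mem_rect] at *
        omega
      · refine Or.inl (Or.inr (b2' u ?_ hu0' huA'))
        have h1 := a1 huA
        rw [mem_rect] at *
        omega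
    · by_cases hux : 0 ≤ u.1
      · refine Or.inl (Or.inl (b2 u ?_ hu0' huA))
        rw [mem_rect] at *
        omega
      · refine Or.inl (Or.inr (b2' u ?_ hu0' fun huA' => ?_))
        · rw [mem_rect] at *
          omega
        · have := a1' huA'
          rw [mem_rect] at this
          omega
  · rintro u ((hu | hu) | ⟨hu, huA, -⟩) hut
    · exact b3 u hu hut
    · exact b3' u hu hut
    · have hut' : u.2 = 2 * h + 1 := hut
      have := t1 hu
      rw [mem_rect] at this
      omega
  · rintro u ((hu | hu) | ⟨hu, huA, huA'⟩) v hv huv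
    · refine Or.inl (Or.inl (b4 u hu v ?_ huv))
      -- Leaving on the left would require a point of `B` on column 0, but that column is covered by
      -- `A` and its reflection.
      by_contra hvR
      have h1 := hb1 u hu
      have h2 := squareLattice_adj.1 huv.1
      rw [mem_rect] at *
      by_cases h3 : u.2 ≤ h
      · exact (b1 hu).2.1 (a2 u (by rw [mem_rect]; omega) (by omega))
      · exact (b1 hu).2.2 (a2 _ (by rw [mem_rect]; simp only; omega) (by simp only; omega))
    · refine Or.inl (Or.inr (b4' u hu v ?_ huv))
      by_contra hvR
      have h1 := b0' hu
      have h2 := squareLattice_adj.1 huv.1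
      rw [mem_rect] at *
      by_cases h3 : u.2 ≤ h
      · exact (b1' u hu).1 (a2' u (by rw [mem_rect]; omega) (by omega))
      · exact (b1' u hu).2 (a2' _ (by rw [mem_rect]; simp only; omega) (by simp only; omega))
    · have h1 := t1 hu
      have h2 := squareLattice_adj.1 huv.1
      have h3 : ¬ u.2 = h := t3 u hu
      have hvS : v ∈ rect 0 (h + 1) 0 h := by
        rw [mem_rect] at *
        omega
      have hvA := a4 u huA v hvS huv
      have hvA' := a4' u huA' v hvS huv
      refine Or.inr ⟨t4 u hu v ?_ huv, hvA, hvA'⟩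
      have h4 := a3 v hvA
      have h5 := a3' v hvA'
      rw [mem_rect] at *
      omega

lemma le_pr_blockV_of_hook {h : ℤ} (hh : 1 ≤ h) :
    1 / 128 ≤ pr (BlockV (1 - h) (2 * h) 0 (2 * h + 1)) := by
  set g := LatticeSymm.reflectX (h + 1)
  have l1 := isLocal_hook hh
  have l2 : IsLocal fun ω => Hook h (g.onEdge '' ω) := l1.comp_image _
  have m2 : IsLowerSet {ω | Hook h (g.onEdge '' ω)} := isLowerSet_comp_image (isLowerSet_hook h) _
  have p1 := eighth_le_pr_hook hh
  have p2 : pr (fun ω => Hook h (g.onEdge '' ω)) = pr (Hook h) := g.pr_comp l1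
  have p3 : 1 / 2 ≤ pr (BlockV 1 h 0 h) := half_le_pr_blockV (by omega) (by omega)
  have k1 := pr_mul_le_pr_and l1 l2 (isLowerSet_hook h) m2
  have k2 := pr_mul_le_pr_and (l1.and l2) isLocal_blockV (isLowerSet_and (isLowerSet_hook h) m2)
    (isLowerSet_blockV (a := 1) (b := h) (c := 0) (d := h))
  have k3 := pr_mono ((l1.and l2).and isLocal_blockV) isLocal_blockV
    fun ω hω => blockV_of_hook hh hω.1.1 hω.1.2 hω.2
  rw [p2] at k1
  have k4 : (1 / 8 : ℝ) * (1 / 8) ≤ pr (Hook h) * pr (Hook h) := by gcongr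
  calc (1 / 128 : ℝ) = (1 / 8) * (1 / 8) * (1 / 2) := by norm_num
    _ ≤ pr (fun ω => Hook h ω ∧ Hook h (g.onEdge '' ω)) * pr (BlockV 1 h 0 h) := by
      gcongr
      · exact pr_nonneg _
      · exact k4.trans k1
    _ ≤ _ := k2.trans k3

/-- The set `G` cuts the overlap into a left and a right part with no open edge between them. The
certificate follows `B` on the left of this cut and `B'` on the right. -/
lemma blockV_glue {a a' b b' c d : ℤ} {ω : Set (ℤ × ℤ)} (ha : a ≤ a') (hb : b ≤ b')
    (hab : a' < b) (h₁ : BlockV a b c d ω) (h₂ : BlockV a' b' c d ω) (h₃ : BlockH a' b c d ω) :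
    BlockV a b' c d ω := by
  obtain ⟨B, b1, b2, b3, b4⟩ := h₁
  obtain ⟨B', b1', b2', b3', b4'⟩ := h₂
  obtain ⟨G, g1, g2, g3, g4⟩ := h₃
  refine ⟨{u | (u ∈ B ∧ (u.1 < a' ∨ u ∈ G)) ∨ (u ∈ B' ∧ (b < u.1 ∨ u.1 ≤ b ∧ u ∉ G))}, ?_, ?_, ?_, ?_⟩
  · rintro u (⟨hu, -⟩ | ⟨hu, -⟩)
    · have := b1 hu
      rw [mem_rect] at *
      omega
    · have := b1' hu
      rw [mem_rect] at *
      omega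
  · intro u hu hus
    rw [mem_rect] at hu
    by_cases h1 : u.1 < a'
    · exact Or.inl ⟨b2 u (by rw [mem_rect]; omega) hus, Or.inl h1⟩
    · by_cases h2 : b < u.1
      · exact Or.inr ⟨b2' u (by rw [mem_rect]; omega) hus, Or.inl h2⟩
      · by_cases hG : u ∈ G
        · exact Or.inl ⟨b2 u (by rw [mem_rect]; omega) hus, Or.inr hG⟩
        · exact Or.inr ⟨b2' u (by rw [mem_rect]; omega) hus, Or.inr ⟨by omega, hG⟩⟩
  · rintro u (⟨hu, -⟩ | ⟨hu, -⟩)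
    · exact b3 u hu
    · exact b3' u hu
  · rintro u hu v hv huv
    have hadj := squareLattice_adj.1 huv.1
    rw [mem_rect] at hv
    have gl : ∀ w ∈ G, a' ≤ w.1 ∧ w.1 < b := fun w hw => by
      have h1 := g1 hw
      have h2 : ¬ w.1 = b := g3 w hw
      rw [mem_rect] at h1
      omega
    rcases hu with ⟨hu, hu'⟩ | ⟨hu, hu'⟩
    · have hub := b1 hu
      rw [mem_rect] at hub
      have hux : u.1 < b := by
        rcases hu' with hu' | hu'
        · omega
        · exact (gl u hu').2
      refine Or.inl ⟨b4 u hu v (by rw [mem_rect]; omega) huv, ?_⟩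
      by_cases hvx : v.1 < a'
      · exact Or.inl hvx
      · right
        rcases hu' with hu' | hu'
        · refine g2 v (by rw [mem_rect]; omega) ?_
          change v.1 = a'
          omega
        · exact g4 u hu' v (by rw [mem_rect]; omega) huv
    · have hub := b1' hu
      rw [mem_rect] at hub
      have hux : a' < u.1 := by
        rcases hu' with hu' | hu'
        · omega
        · by_contra hcon
          exact hu'.2 (g2 u (by rw [mem_rect]; omega) (show u.1 = a' by omega))
      refine Or.inr ⟨b4' u hu v (by rw [mem_rect]; omega) huv, ?_⟩
      by_cases hvx : b < v.1
      · exact Or.inl hvx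
      · refine Or.inr ⟨by omega, fun hvG => ?_⟩
        rcases hu' with hu' | hu'
        · have := gl v hvG
          omega
        · exact hu'.2 (g4 v hvG u (by rw [mem_rect]; omega) huv.symm)

lemma le_pr_blockV_glue {a a' b b' c d : ℤ} (ha : a ≤ a') (hb : b ≤ b') (hcd : c ≤ d)
    (hab : d - c + 1 ≤ b - a') {q q' : ℝ} (h : q ≤ pr (BlockV a b c d))
    (h' : q' ≤ pr (BlockV a' b' c d)) (hq' : 0 ≤ q') :
    q * q' * (1 / 2) ≤ pr (BlockV a b' c d) := by
  have k1 := pr_mul_le_pr_and (isLocal_blockV (a := a) (b := b) (c := c) (d := d))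
    (isLocal_blockV (a := a') (b := b') (c := c) (d := d)) isLowerSet_blockV isLowerSet_blockV
  have k2 := pr_mul_le_pr_and ((isLocal_blockV (a := a) (b := b) (c := c) (d := d)).and
    (isLocal_blockV (a := a') (b := b') (c := c) (d := d)))
    (isLocal_blockH (a := a') (b := b) (c := c) (d := d))
    (isLowerSet_and isLowerSet_blockV isLowerSet_blockV) isLowerSet_blockH
  have k3 := pr_mono ((isLocal_blockV.and isLocal_blockV).and isLocal_blockH) isLocal_blockV
    fun ω (hω : (BlockV a b c d ω ∧ BlockV a' b' c d ω) ∧ BlockH a' b c d ω) => blockV_glue ha hb (by omega) hω.1.1 hω.1.2 hω.2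
  refine le_trans ?_ (k2.trans k3)
  gcongr
  · exact pr_nonneg _
  · refine le_trans ?_ k1
    gcongr
    exact pr_nonneg _
  · exact half_le_pr_blockH hcd hab

/-- A positive lower bound for the probability that a rectangle of bounded aspect ratio is not
crossed by an open path in the short direction. -/
lemma le_pr_blockV_long {m : ℤ} (hm : 0 ≤ m) :
    1 / 2 ^ 23 ≤ pr (BlockV (-(5 * m + 19)) (5 * m + 19) m (5 * m + 19)) := by
  obtain ⟨h, rfl⟩ : ∃ h, m = h := ⟨m, rfl⟩
  -- With this choice `2k + 1` is the height and `5k - 7` the width of the target. Three rectangles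
  -- of width `3k - 1` with overlaps of width `2k + 2`, one more than the height, fill that width;
  -- the cost is 128³ · 2² = 2²³.
  set k : ℤ := 2 * m + 9 with hk
  have base : ∀ x, 1 / 128 ≤ pr (BlockV x (x + (3 * k - 1)) 0 (2 * k + 1)) := by
    intro x
    have e := pr_blockV_add (1 - k) (2 * k) 0 (2 * k + 1) (x + k - 1) 0
    have := le_pr_blockV_of_hook (h := k) (by omega)
    rw [← e] at this
    convert this using 3 <;> omega
  have h1 : (1 / 128 : ℝ) * (1 / 128) * (1 / 2) ≤ pr (BlockV 0 (4 * k - 4) 0 (2 * k + 1)) := by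
    have b0 := base 0
    have b1 := base (k - 3)
    refine le_pr_blockV_glue (a' := k - 3) (b := 3 * k - 1) ?_ ?_ ?_ ?_ ?_ ?_ ?_
    any_goals omega
    any_goals norm_num
    · simpa using b0
    · convert b1 using 3; omega
  have h2 : (1 / 128 : ℝ) * (1 / 128) * (1 / 2) * (1 / 128) * (1 / 2) ≤
      pr (BlockV 0 (5 * k - 7) 0 (2 * k + 1)) := by
    have b1 := base (2 * k - 6)
    refine le_pr_blockV_glue (a' := 2 * k - 6) (b := 4 * k - 4) ?_ ?_ ?_ ?_ h1 ?_ ?_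
    any_goals omega
    any_goals norm_num
    · convert b1 using 3; omega
  have e := pr_blockV_add 0 (5 * k - 7) 0 (2 * k + 1) (-(5 * m + 19)) m
  rw [← e] at h2
  refine le_trans (by norm_num) (h2.trans (pr_mono isLocal_blockV isLocal_blockV fun ω hω => ?_))
  rw [BlockV] at hω ⊢
  have e1 : 0 + m = m := by ring
  have e2 : 2 * k + 1 + m = 5 * m + 19 := by omega
  rw [e1, e2] at hω
  refine hω.mono_domain fun z hz => ?_
  rw [mem_rect] at *
  omega

/-- The supremum norm on `ℤ²`. -/
def supNorm (z : ℤ × ℤ) : ℤ := max (max z.1 (-z.1)) (max z.2 (-z.2))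

/-- The annulus of the points of supremum norm between `m` and `M`. -/
def annulus (m M : ℤ) : Set (ℤ × ℤ) := {z | m ≤ supNorm z ∧ supNorm z ≤ M}

/-- No open path crosses the annulus. -/
def BlockAnnulus (m M : ℤ) : Set (ℤ × ℤ) → Prop :=
  Block (annulus m M) {z | supNorm z = m} {z | supNorm z = M}

lemma finite_annulus (m M : ℤ) : (annulus m M).Finite := by
  refine (finite_rect (-M) M (-M) M).subset fun z hz => ?_
  have h : supNorm z ≤ M := hz.2
  rw [supNorm] at h
  rw [mem_rect]
  omega

lemma isLocal_blockAnnulus (m M : ℤ) : IsLocal (BlockAnnulus m M) :=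
  localOn_block.isLocal (finite_edgesIn (finite_annulus m M))

lemma blockV_image (g : LatticeSymm) {a b c d : ℤ} {ω : Set (ℤ × ℤ)}
    (h : BlockV a b c d (g.onEdge '' ω)) : ∃ B : Set (ℤ × ℤ),
      (∀ u, g.onVertex u ∈ rect a b c d → (g.onVertex u).2 = c → u ∈ B) ∧
      (∀ u ∈ B, (g.onVertex u).2 ≠ d) ∧
      (∀ u ∈ B, ∀ v, g.onVertex v ∈ rect a b c d → IsOpenEdge ω u v → v ∈ B) := by
  obtain ⟨B, -, b2, b3, b4⟩ := h
  exact ⟨g.onVertex ⁻¹' B, fun u hu hu' => b2 _ hu hu', fun u hu => b3 _ hu,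
    fun u hu v hv huv => b4 _ hu _ hv (g.isOpenEdge_image.2 huv)⟩

/-- The reflection exchanging `(x, y)` and `(-y, -x)`. -/
def LatticeSymm.antiSwap : LatticeSymm where
  onVertex := (Equiv.prodComm ℤ ℤ).trans (Equiv.neg (ℤ × ℤ))
  onEdge := (Equiv.prodComm ℤ ℤ).trans (Equiv.neg (ℤ × ℤ))
  adj_iff u v := by simp [squareLattice_adj]; omega
  map_add u v := by ext <;> simp <;> ring

/-- Four long rectangles cover the annulus. A point is kept if it is in the certificate of every
rectangle containing it; a step into a new rectangle lands on its inner side, which its certificate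
contains. -/
lemma blockAnnulus_of_blockV {m M : ℤ} (hm : 0 ≤ m) (hmM : m < M) {ω : Set (ℤ × ℤ)}
    (h₁ : BlockV (-M) M m M ω)
    (h₂ : BlockV (-M) M m M ((LatticeSymm.reflectY 0).onEdge '' ω))
    (h₃ : BlockV (-M) M m M (LatticeSymm.swap.onEdge '' ω))
    (h₄ : BlockV (-M) M m M (LatticeSymm.antiSwap.onEdge '' ω)) : BlockAnnulus m M ω := by
  obtain ⟨B₁, -, s1, t1, c1⟩ := h₁
  obtain ⟨B₂, s2, t2, c2⟩ := blockV_image _ h₂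
  obtain ⟨B₃, s3, t3, c3⟩ := blockV_image _ h₃
  obtain ⟨B₄, s4, t4, c4⟩ := blockV_image _ h₄
  have e2 : ∀ u : ℤ × ℤ, (LatticeSymm.reflectY 0).onVertex u = (u.1, -u.2) := fun u => by
    ext <;> simp [LatticeSymm.reflectY]
  have e3 : ∀ u : ℤ × ℤ, LatticeSymm.swap.onVertex u = (u.2, u.1) := fun u => rfl
  have e4 : ∀ u : ℤ × ℤ, LatticeSymm.antiSwap.onVertex u = (-u.2, -u.1) := fun u => rfl
  simp only [e2, e3, e4, mem_rect] at *
  refine ⟨{u | u ∈ annulus m M ∧ (m ≤ u.2 → u ∈ B₁) ∧ (m ≤ -u.2 → u ∈ B₂) ∧ (m ≤ u.1 → u ∈ B₃) ∧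
    (m ≤ -u.1 → u ∈ B₄)}, fun u hu => hu.1, ?_, ?_, ?_⟩
  · intro u hu hum
    have hum' : supNorm u = m := hum
    rw [supNorm] at hum'
    exact ⟨hu, fun h => s1 u (by omega) (show u.2 = m by omega),
      fun h => s2 u (by omega) (by omega), fun h => s3 u (by omega) (by omega),
      fun h => s4 u (by omega) (by omega)⟩
  · rintro u ⟨hu, h1, h2, h3, h4⟩ huM
    have huM' : supNorm u = M := huM
    rw [supNorm] at huM'
    have hcases : u.2 = M ∨ -u.2 = M ∨ u.1 = M ∨ -u.1 = M := by omega
    rcases hcases with h | h | h | h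
    · exact t1 u (h1 (by omega)) h
    · exact t2 u (h2 (by omega)) h
    · exact t3 u (h3 (by omega)) h
    · exact t4 u (h4 (by omega)) h
  · rintro u ⟨hu, h1, h2, h3, h4⟩ v hv huv
    have hadj := squareLattice_adj.1 huv.1
    have hvM : supNorm v ≤ M := hv.2
    rw [supNorm] at hvM
    refine ⟨hv, fun h => ?_, fun h => ?_, fun h => ?_, fun h => ?_⟩
    · by_cases hu' : m ≤ u.2
      · exact c1 u (h1 hu') v (by omega) huv
      · exact s1 v (by omega) (show v.2 = m by omega)
    · by_cases hu' : m ≤ -u.2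
      · exact c2 u (h2 hu') v (by omega) huv
      · exact s2 v (by omega) (by omega)
    · by_cases hu' : m ≤ u.1
      · exact c3 u (h3 hu') v (by omega) huv
      · exact s3 v (by omega) (by omega)
    · by_cases hu' : m ≤ -u.1
      · exact c4 u (h4 hu') v (by omega) huv
      · exact s4 v (by omega) (by omega)

lemma le_pr_blockAnnulus {m : ℤ} (hm : 0 ≤ m) :
    (1 / 2 ^ 23) ^ 4 ≤ pr (BlockAnnulus m (5 * m + 19)) := by
  set M := 5 * m + 19 with hM
  set A := BlockV (-M) M m M with hA
  have p := le_pr_blockV_long hm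
  rw [← hM, ← hA] at p
  have l : IsLocal A := isLocal_blockV
  have w : IsLowerSet {ω | A ω} := isLowerSet_blockV
  have key : ∀ (C : Set (ℤ × ℤ) → Prop) (q : ℝ) (g : LatticeSymm), 0 ≤ q → IsLocal C →
      IsLowerSet {ω | C ω} → q ≤ pr C → q * (1 / 2 ^ 23) ≤ pr fun ω => C ω ∧ A (g.onEdge '' ω) := by
    intro C q g hq hC hC' h
    refine le_trans ?_ (pr_mul_le_pr_and hC (l.comp_image g.onEdge) hC' (isLowerSet_comp_image w _))
    rw [g.pr_comp l]
    gcongr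
    exact pr_nonneg _
  have k1 := key A _ (LatticeSymm.reflectY 0) (by norm_num) l w p
  have l1 := l.and (l.comp_image (LatticeSymm.reflectY 0).onEdge)
  have w1 := isLowerSet_and w (isLowerSet_comp_image w (LatticeSymm.reflectY 0).onEdge)
  have k2 := key _ _ LatticeSymm.swap (by norm_num) l1 w1 k1
  have l2 := l1.and (l.comp_image LatticeSymm.swap.onEdge)
  have w2 := isLowerSet_and w1 (isLowerSet_comp_image w LatticeSymm.swap.onEdge)
  have k3 := key _ _ LatticeSymm.antiSwap (by norm_num) l2 w2 k2
  have l3 := l2.and (l.comp_image LatticeSymm.antiSwap.onEdge)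
  refine le_trans (le_of_eq (by norm_num)) (k3.trans (pr_mono l3 (isLocal_blockAnnulus m M) ?_))
  exact fun ω hω => blockAnnulus_of_blockV hm (by omega) hω.1.1.1 hω.1.1.2 hω.1.2 hω.2

/-- The inner radii of a sequence of disjoint annuli. -/
def innerRadius : ℕ → ℤ
  | 0 => 0
  | k + 1 => 5 * innerRadius k + 20

lemma innerRadius_nonneg (k : ℕ) : 0 ≤ innerRadius k := by
  induction k with
  | zero => exact le_rfl
  | succ k ih => rw [innerRadius]; omega

lemma innerRadius_mono : Monotone innerRadius :=
  monotone_nat_of_le_succ fun k => by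
    have := innerRadius_nonneg k
    rw [innerRadius]
    omega

/-- Each inner radius is one more than the previous outer radius, so the annuli share no edge and
the events are independent. -/
lemma pr_no_blockAnnulus_le (k : ℕ) :
    pr (fun ω => ∀ i < k, ¬ BlockAnnulus (innerRadius i) (5 * innerRadius i + 19) ω) ≤
      (1 - (1 / 2 ^ 23) ^ 4) ^ k := by
  have hloc : ∀ k : ℕ, LocalOn (edgesIn (annulus 0 (innerRadius k - 1)))
      fun ω => ∀ i < k, ¬ BlockAnnulus (innerRadius i) (5 * innerRadius i + 19) ω := by
    intro k T T' h
    refine forall₂_congr fun i hi => not_congr ?_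
    refine (localOn_block.mono (edgesIn_mono ?_)) T T' h
    rintro z ⟨h1, h2⟩
    have h3 := innerRadius_mono (Nat.succ_le_of_lt hi)
    have h4 := innerRadius_nonneg i
    rw [Nat.succ_eq_add_one, innerRadius] at h3
    exact ⟨by omega, by omega⟩
  induction k with
  | zero =>
    simp only [not_lt_zero, false_imp_iff, implies_true, pow_zero]
    rw [pr_eq (F := ∅) (fun _ _ _ => Iff.rfl), prob, avg_empty]
    simp
  | succ k ih =>
    have hl : LocalOn (edgesIn (annulus (innerRadius k) (5 * innerRadius k + 19)))
        fun ω => ¬ BlockAnnulus (innerRadius k) (5 * innerRadius k + 19) ω := localOn_block.not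
    have e := pr_and_of_disjoint (hloc k) hl (finite_edgesIn (finite_annulus _ _))
      (finite_edgesIn (finite_annulus _ _)) (disjoint_edgesIn (by
        rw [Set.disjoint_left]
        rintro z ⟨-, h1⟩ ⟨h2, -⟩
        omega))
    have e' : (fun ω => ∀ i < k + 1, ¬ BlockAnnulus (innerRadius i) (5 * innerRadius i + 19) ω) =
        fun ω => (∀ i < k, ¬ BlockAnnulus (innerRadius i) (5 * innerRadius i + 19) ω) ∧
          ¬ BlockAnnulus (innerRadius k) (5 * innerRadius k + 19) ω := by
      ext ω
      exact Nat.forall_lt_succ_right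
    rw [e', e, pow_succ, pr_not (isLocal_blockAnnulus _ _)]
    have := le_pr_blockAnnulus (innerRadius_nonneg k)
    gcongr
    · have := pr_mono (isLocal_blockAnnulus (innerRadius k) (5 * innerRadius k + 19))
        (⟨∅, fun _ _ _ => Iff.rfl⟩ : IsLocal fun _ : Set (ℤ × ℤ) => True) fun _ _ => trivial
      rw [pr_eq (A := fun _ => True) (F := ∅) (fun _ _ _ => Iff.rfl), prob, avg_empty] at this
      simpa using this

/-- Adding random edges can only help an increasing event. This gives a bound uniform in the finite
set of observed edges. -/
lemma prob_le_pr {ι : Type*} {A : Set ι → Prop} (hA : IsLocal A) (hA' : IsUpperSet {ω | A ω})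
    (F : Finset ι) : prob F A ≤ pr A := by
  classical
  obtain ⟨K, hK⟩ := hA
  rw [pr_eq (hK.mono (Finset.coe_subset.2 (Finset.subset_union_right (s₁ := F)))), prob, prob,
    ← Finset.union_sdiff_self_eq_union, avg_union Finset.disjoint_sdiff]
  refine avg_mono fun T _ => ?_
  rw [← avg_const (K \ F) (if A T then 1 else 0)]
  refine avg_mono fun S _ => ?_
  have : A T → A (T ∪ S) := fun h => hA' Set.subset_union_left h
  split_ifs <;> simp_all

/-- In fair percolation, the probability that the origin is not separated from a point by a closed
set tends to `0` as the point goes to infinity. -/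
theorem exists_pr_not_separated_le {δ : ℝ} (hδ : 0 < δ) : ∃ (M : ℤ) (A : Set (ℤ × ℤ) → Prop),
    IsLocal A ∧ IsUpperSet {ω | A ω} ∧ pr A ≤ δ ∧ ∀ ω, ¬ A ω → ∃ K : Set (ℤ × ℤ), 0 ∈ K ∧ (∀ u ∈ K, supNorm u < M) ∧
      ∀ u ∈ K, ∀ v, IsOpenEdge ω u v → v ∈ K := by
  obtain ⟨k, hk⟩ := exists_pow_lt_of_lt_one hδ
    (show (1 : ℝ) - (1 / 2 ^ 23) ^ 4 < 1 by norm_num)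
  refine ⟨innerRadius k, fun ω => ∀ i < k,
    ¬ BlockAnnulus (innerRadius i) (5 * innerRadius i + 19) ω, ?_,
    fun ω ω' h hω i hi hb => hω i hi (isLowerSet_block h hb),
    (pr_no_blockAnnulus_le k).trans hk.le, ?_⟩
  · refine LocalOn.isLocal (E := edgesIn (annulus 0 (innerRadius k))) ?_
      (finite_edgesIn (finite_annulus _ _))
    intro T T' h
    refine forall₂_congr fun i hi => not_congr ?_
    refine (localOn_block.mono (edgesIn_mono ?_)) T T' h
    rintro z ⟨h1, h2⟩
    have h3 := innerRadius_mono (Nat.succ_le_of_lt hi)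
    have h4 := innerRadius_nonneg i
    rw [Nat.succ_eq_add_one, innerRadius] at h3
    exact ⟨by omega, by omega⟩
  · intro ω hω
    push Not at hω
    obtain ⟨i, hi, B, b1, b2, b3, b4⟩ := hω
    have h3 := innerRadius_mono (Nat.succ_le_of_lt hi)
    rw [Nat.succ_eq_add_one, innerRadius] at h3
    have hm := innerRadius_nonneg i
    set m := innerRadius i
    have hBM : ∀ u ∈ B, supNorm u < 5 * m + 19 := fun u hu => by
      have h1 : supNorm u ≤ 5 * m + 19 := (b1 hu).2
      have h2 : ¬ supNorm u = 5 * m + 19 := b3 u hu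
      omega
    have hs : ∀ u, supNorm u = m → u ∈ B := fun u hu => b2 u ⟨hu.ge, by omega⟩ hu
    have hstep : ∀ u v : ℤ × ℤ, squareLattice.Adj u v → supNorm v ≤ supNorm u + 1 := by
      intro u v h
      rw [squareLattice_adj] at h
      rw [supNorm, supNorm]
      omega
    -- Filling the hole of the blocked annulus turns its certificate into a set around the origin
    -- closed under all open steps.
    refine ⟨{u | supNorm u < m ∨ u ∈ B}, ?_, ?_, ?_⟩
    · by_cases h0 : 0 < m
      · exact Or.inl h0
      · exact Or.inr (hs 0 (by change (0 : ℤ) = m; omega))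
    · rintro u (hu | hu)
      · omega
      · have := hBM u hu
        omega
    · rintro u (hu | hu) v huv
      · have := hstep u v huv.1
        by_cases hv : supNorm v < m
        · exact Or.inl hv
        · exact Or.inr (hs v (by omega))
      · have h1 := hstep u v huv.1
        have h2 := hBM u hu
        by_cases hv : supNorm v < m
        · exact Or.inl hv
        · exact Or.inr (b4 u hu v ⟨by omega, by omega⟩ huv)

end Annuli

/-! ### Comparison of noisy observations with random exact observations. -/

section InformationPercolation

/-- A bounded nonnegative measurable function. -/
def IsWeight {X : Type*} [MeasurableSpace X] (w : X → ℝ) : Prop :=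
  Measurable w ∧ (∀ x, 0 ≤ w x) ∧ ∃ C, ∀ x, w x ≤ C

/-- A measurable function taking values in `{-1, 1}`. -/
def IsSign {X : Type*} [MeasurableSpace X] (s : X → ℝ) : Prop :=
  Measurable s ∧ ∀ x, s x = 1 ∨ s x = -1

/-- `-1` on `U` and `1` elsewhere. -/
noncomputable def signOn {ι : Type*} (U : Set ι) (e : ι) : ℝ :=
  open Classical in if e ∈ U then -1 else 1

variable {X ι : Type*} [MeasurableSpace X] {μ : Measure X}

lemma IsWeight.integrable [IsFiniteMeasure μ] {w : X → ℝ} (hw : IsWeight w) : Integrable w μ := by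
  obtain ⟨h1, h2, C, hC⟩ := hw
  exact Integrable.of_bound h1.aestronglyMeasurable C
    (ae_of_all _ fun x => by rw [Real.norm_of_nonneg (h2 x)]; exact hC x)

lemma IsSign.abs_eq {s : X → ℝ} (hs : IsSign s) (x : X) : |s x| = 1 := by
  rcases hs.2 x with h | h <;> simp [h]

lemma IsSign.integrable_mul {s w : X → ℝ} (hs : IsSign s) (hw : Integrable w μ) :
    Integrable (fun x => s x * w x) μ :=
  hw.bdd_mul hs.1.aestronglyMeasurable (ae_of_all _ fun x => (hs.abs_eq x).le)

lemma IsWeight.mul {w : X → ℝ} (hw : IsWeight w) {s : X → ℝ} (hs : IsSign s) {θ : ℝ}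
    (hθ : |θ| ≤ 1) : IsWeight fun x => w x * ((1 + θ * s x) / 2) := by
  obtain ⟨h1, h2, C, hC⟩ := hw
  rw [abs_le] at hθ
  have hb : ∀ x, 0 ≤ (1 + θ * s x) / 2 ∧ (1 + θ * s x) / 2 ≤ 1 := fun x => by
    rcases hs.2 x with h | h <;> rw [h] <;> constructor <;> linarith
  refine ⟨h1.mul (((hs.1.const_mul θ).const_add 1).div_const 2),
    fun x => mul_nonneg (h2 x) (hb x).1, C, fun x => ?_⟩
  exact (mul_le_of_le_one_right (h2 x) (hb x).2).trans (hC x)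

/-- `(∫ f w)² / ∫ w`, the second moment of the conditional mean of `f` on an event of density
`w`. -/
noncomputable def condSq (μ : Measure X) (f w : X → ℝ) : ℝ :=
  (∫ x, f x * w x ∂μ) ^ 2 / ∫ x, w x ∂μ

/-- The second moment of the conditional mean of `f` given noisy observations of the signs `s e`,
`e ∈ F`; the observation of `s e` is correct with probability `(1 + θ) / 2`. -/
noncomputable def infoSum (μ : Measure X) (f : X → ℝ) (s : ι → X → ℝ) (θ : ℝ) (F : Finset ι)
    (w : X → ℝ) : ℝ :=
  ∑ U ∈ F.powerset, condSq μ f fun x => w x * ∏ e ∈ F, (1 + θ * (signOn U e * s e x)) / 2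

/-- Here `z`, `a`, `b`, `c` are the integrals of `w`, `f w`, `s w`, `s f w`. Observing `s` at level
`t` adds `(cz - ab)² / z · t² / (z² - t²b²)` to `a² / z`, and `t = 1` is exact observation. -/
lemma condSq_step_real {a b c z t : ℝ} (hz : 0 ≤ z) (h1 : |a + c| ≤ z + b) (h2 : |a - c| ≤ z - b)
    (ht : t ^ 2 ≤ 1 / 2) :
    ((a + t * c) / 2) ^ 2 / ((z + t * b) / 2) + ((a - t * c) / 2) ^ 2 / ((z - t * b) / 2) ≤
      1 / 2 * (((a + c) / 2) ^ 2 / ((z + b) / 2) + ((a - c) / 2) ^ 2 / ((z - b) / 2)) +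
        1 / 2 * (a ^ 2 / z) := by
  have hp := (abs_nonneg _).trans h1
  have hm := (abs_nonneg _).trans h2
  have ht1 : |t| < 1 := (sq_lt_one_iff_abs_lt_one t).1 (by linarith)
  obtain ⟨hta, htb⟩ := abs_lt.1 ht1
  -- Degenerate cases: a vanishing denominator forces its numerator to vanish, division by zero
  -- gives zero, and the two sides agree.
  rcases hz.eq_or_lt with rfl | hz
  · have hb : b = 0 := by linarith
    subst hb
    have e1 : a + c = 0 := by simpa using h1
    have e2 : a - c = 0 := by simpa using h2
    simp
  rcases hp.eq_or_lt with hp' | hp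
  · have hb : b = -z := by linarith
    subst hb
    have e1 : c = -a := by
      rw [← hp', abs_nonpos_iff] at h1
      linarith
    subst e1
    have g1 : z + t * -z ≠ 0 := by nlinarith
    have g2 : z - t * -z ≠ 0 := by nlinarith
    have g3 : (1 - t) ≠ 0 := by linarith
    have g4 : (1 + t) ≠ 0 := by linarith
    have g1' : z + t * -z = z * (1 - t) := by ring
    have g2' : z - t * -z = z * (1 + t) := by ring
    rw [g1', g2']
    refine le_of_eq ?_
    simp only [add_neg_cancel, sub_neg_eq_add]
    field_simp
    ring
  rcases hm.eq_or_lt with hm' | hm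
  · have hb : b = z := by linarith
    subst hb
    have e1 : c = a := by
      rw [← hm', abs_nonpos_iff] at h2
      linarith
    subst e1
    have g3 : (1 - t) ≠ 0 := by linarith
    have g4 : (1 + t) ≠ 0 := by linarith
    have g1' : b + t * b = b * (1 + t) := by ring
    have g2' : b - t * b = b * (1 - t) := by ring
    rw [g1', g2']
    refine le_of_eq ?_
    simp only [sub_self]
    field_simp
    ring
  have q1 : 0 < z + t * b := by
    rcases le_total 0 b with hb | hb <;> nlinarith
  have q2 : 0 < z - t * b := by
    rcases le_total 0 b with hb | hb <;> nlinarith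
  have l : ((a + t * c) / 2) ^ 2 / ((z + t * b) / 2) + ((a - t * c) / 2) ^ 2 / ((z - t * b) / 2) =
      a ^ 2 / z + (c * z - a * b) ^ 2 / z * (t ^ 2 / ((z + t * b) * (z - t * b))) := by
    field_simp
    ring
  have r : ((a + c) / 2) ^ 2 / ((z + b) / 2) + ((a - c) / 2) ^ 2 / ((z - b) / 2) =
      a ^ 2 / z + (c * z - a * b) ^ 2 / z * (1 / ((z + b) * (z - b))) := by
    field_simp
    ring
  rw [l, r]
  -- The numerator is at most 1/2 by hypothesis, and `z² - b² ≤ z² - t²b²`.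
  have k : t ^ 2 / ((z + t * b) * (z - t * b)) ≤ 1 / 2 * (1 / ((z + b) * (z - b))) := by
    rw [mul_one_div]
    have hle : (z + b) * (z - b) ≤ (z + t * b) * (z - t * b) := by nlinarith [sq_nonneg b]
    have hpos : 0 < (z + b) * (z - b) := mul_pos hp hm
    gcongr
  have k' := mul_le_mul_of_nonneg_left k (by positivity : 0 ≤ (c * z - a * b) ^ 2 / z)
  linarith

lemma integral_mul_sign {f w s : X → ℝ} (hf : Integrable (fun x => f x * w x) μ)
    (hs : IsSign s) (θ : ℝ) : ∫ x, f x * (w x * ((1 + θ * s x) / 2)) ∂μ =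
      (∫ x, f x * w x ∂μ + θ * ∫ x, s x * (f x * w x) ∂μ) / 2 := by
  rw [← integral_const_mul, ← integral_add hf ((hs.integrable_mul hf).const_mul θ),
    ← integral_div]
  congr 1
  ext x
  ring

lemma abs_integral_mul_le [IsFiniteMeasure μ] {f w : X → ℝ} (hf : IsSign f) (hw : IsWeight w) :
    |∫ x, f x * w x ∂μ| ≤ ∫ x, w x ∂μ := by
  refine (abs_integral_le_integral_abs).trans (integral_mono (hf.integrable_mul hw.integrable).abs
    hw.integrable fun x => ?_)
  simp only [abs_mul, hf.abs_eq, one_mul, abs_of_nonneg (hw.2.1 x), le_refl]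

/-- Replacing a noisy observation of a sign by an exact one with probability `1/2`, and none
otherwise, increases the information. -/
lemma condSq_step [IsFiniteMeasure μ] {f s w : X → ℝ} (hf : IsSign f) (hs : IsSign s) (hw : IsWeight w) {t : ℝ}
    (ht : t ^ 2 ≤ 1 / 2) :
    condSq μ f (fun x => w x * ((1 + t * s x) / 2)) +
      condSq μ f (fun x => w x * ((1 + t * -s x) / 2)) ≤
    1 / 2 * (condSq μ f (fun x => w x * ((1 + 1 * s x) / 2)) +
      condSq μ f (fun x => w x * ((1 + 1 * -s x) / 2))) + 1 / 2 * condSq μ f w := by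
  have hfw := hf.integrable_mul (μ := μ) hw.integrable
  have hs' : IsSign fun x => -s x := ⟨hs.1.neg, fun x => by rcases hs.2 x with h | h <;> simp [h]⟩
  have one : IsSign fun _ : X => (1 : ℝ) := ⟨measurable_const, fun _ => Or.inl rfl⟩
  have i1 : ∀ θ, ∫ x, w x * ((1 + θ * s x) / 2) ∂μ =
      (∫ x, w x ∂μ + θ * ∫ x, s x * w x ∂μ) / 2 := fun θ => by
    simpa using integral_mul_sign (f := fun _ => (1 : ℝ)) (by simpa using hw.integrable) hs θ
  have i2 : ∀ θ, ∫ x, w x * ((1 + θ * -s x) / 2) ∂μ =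
      (∫ x, w x ∂μ - θ * ∫ x, s x * w x ∂μ) / 2 := fun θ => by
    have := i1 (-θ)
    simp only [neg_mul, ← mul_neg] at this
    rw [this, mul_neg, sub_eq_add_neg]
  have j1 := fun θ => integral_mul_sign (μ := μ) hfw hs θ
  have j2 : ∀ θ, ∫ x, f x * (w x * ((1 + θ * -s x) / 2)) ∂μ =
      (∫ x, f x * w x ∂μ - θ * ∫ x, s x * (f x * w x) ∂μ) / 2 := fun θ => by
    have := j1 (-θ)
    simp only [neg_mul, ← mul_neg] at this
    rw [this, mul_neg, sub_eq_add_neg]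
  have b1 := abs_integral_mul_le (μ := μ) hf (hw.mul hs (θ := 1) (by simp))
  have b2 := abs_integral_mul_le (μ := μ) hf (hw.mul hs' (θ := 1) (by simp))
  simp only [condSq]
  simp only [i1, i2, j1, j2] at b1 b2 ⊢
  rw [abs_div, abs_two, div_le_div_iff_of_pos_right two_pos, one_mul, one_mul] at b1 b2
  simp only [one_mul]
  exact condSq_step_real (integral_nonneg hw.2.1) b1 b2 ht

lemma signOn_insert_of_ne {U : Set ι} {a e : ι} (h : e ≠ a) :
    signOn (insert a U) e = signOn U e := by
  have : e ∈ insert a U ↔ e ∈ U := by rw [Set.mem_insert_iff, or_iff_right h]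
  unfold signOn
  split_ifs <;> first | rfl | tauto

lemma isSign_signOn_mul {s : X → ℝ} (hs : IsSign s) (U : Set ι) (e : ι) :
    IsSign fun x => signOn U e * s x := by
  refine ⟨hs.1.const_mul _, fun x => ?_⟩
  simp only [signOn]
  rcases hs.2 x with h | h <;> rw [h] <;> split_ifs <;> simp

lemma IsWeight.mul_prod {w : X → ℝ} (hw : IsWeight w) {s : ι → X → ℝ} (hs : ∀ e, IsSign (s e))
    {θ : ℝ} (hθ : |θ| ≤ 1) (F : Finset ι) (U : Set ι) :
    IsWeight fun x => w x * ∏ e ∈ F, (1 + θ * (signOn U e * s e x)) / 2 := by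
  classical
  induction F using Finset.induction_on with
  | empty => simpa using hw
  | insert a F ha ih =>
    convert ih.mul (isSign_signOn_mul (hs a) U a) hθ using 2
    rw [Finset.prod_insert ha]
    ring

lemma sum_powerset_sign [DecidableEq ι] {F : Finset ι} {a : ι} (ha : a ∉ F)
    {Z : Type*} (s : ι → Z → ℝ)
    (θ : ℝ) (w : Z → ℝ) (Φ : (Z → ℝ) → ℝ) :
    ∑ U ∈ (insert a F).powerset,
      Φ (fun x => w x * ∏ e ∈ insert a F, (1 + θ * (signOn (U : Set ι) e * s e x)) / 2) =
    ∑ U ∈ F.powerset,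
      (Φ (fun x => w x * (∏ e ∈ F, (1 + θ * (signOn (U : Set ι) e * s e x)) / 2) *
        ((1 + θ * s a x) / 2)) +
       Φ (fun x => w x * (∏ e ∈ F, (1 + θ * (signOn (U : Set ι) e * s e x)) / 2) *
        ((1 + θ * -s a x) / 2))) := by
  rw [Finset.sum_powerset_insert ha, ← Finset.sum_add_distrib]
  refine Finset.sum_congr rfl fun U hU => ?_
  have haU : a ∉ U := fun h => ha (Finset.mem_powerset.1 hU h)
  congr 2
  · ext x
    rw [Finset.prod_insert ha]
    have : signOn (U : Set ι) a = 1 := by simp [signOn, haU]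
    rw [this, one_mul]
    ring
  · ext x
    rw [Finset.prod_insert ha]
    have : signOn ((insert a U : Finset ι) : Set ι) a = -1 := by simp [signOn]
    have hne : ∀ e ∈ F, signOn ((insert a U : Finset ι) : Set ι) e = signOn (U : Set ι) e :=
      fun e he => by
        rw [Finset.coe_insert, signOn_insert_of_ne]
        rintro rfl
        exact ha he
    rw [this, neg_one_mul, Finset.prod_congr rfl fun e he => by rw [hne e he]]
    ring

lemma infoSum_insert [DecidableEq ι] {F : Finset ι} {a : ι} (ha : a ∉ F) (f : X → ℝ)
    (s : ι → X → ℝ) (θ : ℝ) (w : X → ℝ) : infoSum μ f s θ (insert a F) w =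
      infoSum μ f s θ F (fun x => w x * ((1 + θ * s a x) / 2)) +
      infoSum μ f s θ F (fun x => w x * ((1 + θ * -s a x) / 2)) := by
  rw [infoSum, sum_powerset_sign ha, infoSum, infoSum, ← Finset.sum_add_distrib]
  simp only [mul_right_comm]

lemma condSq_le [IsFiniteMeasure μ] {f w : X → ℝ} (hf : IsSign f) (hw : IsWeight w) :
    condSq μ f w ≤ ∫ x, w x ∂μ := by
  have h := abs_integral_mul_le (μ := μ) hf hw
  have h0 : 0 ≤ ∫ x, w x ∂μ := integral_nonneg hw.2.1
  rw [condSq, ← sq_abs]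
  refine div_le_of_le_mul₀ h0 h0 ?_
  rw [sq]
  gcongr

lemma infoSum_le [IsFiniteMeasure μ] {f w : X → ℝ} {s : ι → X → ℝ} (hf : IsSign f) (hs : ∀ e, IsSign (s e))
    (hw : IsWeight w) {θ : ℝ} (hθ : |θ| ≤ 1) (F : Finset ι) :
    infoSum μ f s θ F w ≤ ∫ x, w x ∂μ := by
  classical
  induction F using Finset.induction_on generalizing w with
  | empty => simpa [infoSum] using condSq_le hf hw
  | insert a F ha ih =>
    have hs' : IsSign fun x => -s a x :=
      ⟨(hs a).1.neg, fun x => by rcases (hs a).2 x with h | h <;> simp [h]⟩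
    have w1 := hw.mul (hs a) hθ
    have w2 := hw.mul hs' hθ
    rw [infoSum_insert ha]
    refine (add_le_add (ih w1) (ih w2)).trans (le_of_eq ?_)
    rw [← integral_add w1.integrable w2.integrable]
    congr 1
    ext x
    ring

/-- Noisy observations of signs are less informative than exact observations of a random half of
the signs. -/
theorem infoSum_le_avg [IsFiniteMeasure μ] {f w : X → ℝ} {s : ι → X → ℝ} (hf : IsSign f) (hs : ∀ e, IsSign (s e))
    (hw : IsWeight w) {t : ℝ} (ht : t ^ 2 ≤ 1 / 2) (F : Finset ι) :
    infoSum μ f s t F w ≤ (∑ T ∈ F.powerset, infoSum μ f s 1 T w) / 2 ^ F.card := by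
  classical
  induction F using Finset.induction_on generalizing w with
  | empty => simp [infoSum]
  | insert a F ha ih =>
    have hs' : IsSign fun x => -s a x :=
      ⟨(hs a).1.neg, fun x => by rcases (hs a).2 x with h | h <;> simp [h]⟩
    have ht1 : |t| ≤ 1 := abs_le_one_iff_mul_self_le_one.2 (by nlinarith)
    -- Only the observation of `a` is replaced here, given each outcome of the noisy observations on
    -- `F`. The induction hypothesis, valid for all weights, then treats `F`.
    have step : infoSum μ f s t (insert a F) w ≤
        1 / 2 * (infoSum μ f s t F (fun x => w x * ((1 + 1 * s a x) / 2)) +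
          infoSum μ f s t F (fun x => w x * ((1 + 1 * -s a x) / 2))) +
        1 / 2 * infoSum μ f s t F w := by
      rw [infoSum, sum_powerset_sign ha]
      simp only [infoSum]
      rw [← Finset.sum_add_distrib, Finset.mul_sum, Finset.mul_sum, ← Finset.sum_add_distrib]
      refine Finset.sum_le_sum fun U _ => ?_
      have := condSq_step (μ := μ) hf (hs a) (hw.mul_prod hs ht1 F U) ht
      simp only [mul_right_comm (w _) _ (_ / 2)] at this ⊢
      exact this
    have i1 := ih (hw.mul (hs a) (θ := 1) (by simp))
    have i2 := ih (hw.mul hs' (θ := 1) (by simp))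
    have i3 := ih hw
    rw [Finset.sum_powerset_insert ha, Finset.card_insert_of_notMem ha]
    have e : ∑ T ∈ F.powerset, infoSum μ f s 1 (insert a T) w =
        ∑ T ∈ F.powerset, infoSum μ f s 1 T (fun x => w x * ((1 + 1 * s a x) / 2)) +
        ∑ T ∈ F.powerset, infoSum μ f s 1 T (fun x => w x * ((1 + 1 * -s a x) / 2)) := by
      rw [← Finset.sum_add_distrib]
      refine Finset.sum_congr rfl fun T hT => infoSum_insert (fun h => ha ?_) f s 1 w
      exact Finset.mem_powerset.1 hT h
    rw [e]
    refine step.trans ?_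
    rw [pow_succ, ← div_div, add_div, add_div, add_div, add_div]
    linarith

end InformationPercolation

/-! ### Spin flips and the absence of information across a separation. -/

section Flip

variable {V : Type*}

/-- The sign `±1` as a real number. -/
def signVal (a : ℤˣ) : ℝ := ((a : ℤ) : ℝ)

lemma signVal_eq (a : ℤˣ) : signVal a = 1 ∨ signVal a = -1 := by
  rcases Int.units_eq_one_or a with rfl | rfl <;> simp [signVal]

lemma signVal_neg (a : ℤˣ) : signVal (-a) = -signVal a := by simp [signVal]

lemma isSign_signVal {X : Type*} [MeasurableSpace X] {g : X → ℤˣ} (hg : Measurable g) :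
    IsSign fun x => signVal (g x) :=
  ⟨(Measurable.of_discrete (f := signVal)).comp hg, fun x => signVal_eq (g x)⟩

open Classical in
/-- Flip the spins of the vertices of `K`. -/
noncomputable def flipSpins (K : Set V) (x : V → ℤˣ) (u : V) : ℤˣ := if u ∈ K then -x u else x u

lemma measurable_flipSpins (K : Set V) : Measurable (flipSpins K) := by
  refine measurable_pi_lambda _ fun u => ?_
  unfold flipSpins
  by_cases h : u ∈ K
  · simp only [h, if_true]
    exact (Measurable.of_discrete (f := fun a : ℤˣ => -a)).comp (measurable_pi_apply u)
  · simp only [h, if_false]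
    exact measurable_pi_apply u

lemma measurePreserving_flipSpins (K : Set V) : MeasurePreserving (flipSpins K) (spinLaw V) (spinLaw V) := by
  classical
  refine ⟨measurable_flipSpins K, ?_⟩
  have h := Measure.infinitePi_map_pi (fun _ : V => (PMF.uniformOfFintype ℤˣ).toMeasure)
    (f := fun u a => if u ∈ K then -a else a) fun _ => Measurable.of_discrete
  rw [spinLaw]
  refine Eq.trans ?_ (h.trans ?_)
  · congr 1
  · congr 1
    ext1 u
    refine Measure.ext_iff_singleton.2 fun a => ?_
    rw [Measure.map_apply Measurable.of_discrete (.of_discrete)]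
    by_cases hu : u ∈ K
    · have : (fun a : ℤˣ => if u ∈ K then -a else a) ⁻¹' {a} = {-a} := by
        ext b
        simp [hu]
      rw [this, PMF.toMeasure_apply_singleton _ _ .of_discrete,
        PMF.toMeasure_apply_singleton _ _ .of_discrete]
      simp
    · have : (fun a : ℤˣ => if u ∈ K then -a else a) ⁻¹' {a} = {a} := by
        ext b
        simp [hu]
      rw [this]

lemma edgeSpin_flipSpins {K : Set V} (x : V → ℤˣ) {u v : V} (h : u ∈ K ↔ v ∈ K) :
    edgeSpin (flipSpins K x) s(u, v) = edgeSpin x s(u, v) := by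
  simp only [edgeSpin, Sym2.lift_mk, flipSpins]
  by_cases hu : u ∈ K
  · simp [hu, h.1 hu]
  · simp [hu, mt h.2 hu]

/-- If a set of vertices separates `u` from `v` and is not crossed by an edge of `T`, then the
spins on the edges of `T` carry no information about `x u * x v`. -/
lemma infoSum_eq_zero_of_separated {G : SimpleGraph V} {u v : V} {K : Set V} (hu : u ∈ K)
    (hv : v ∉ K) {T : Finset G.edgeSet}
    (hT : ∀ a b, ∀ h : s(a, b) ∈ G.edgeSet, ⟨s(a, b), h⟩ ∈ T → (a ∈ K ↔ b ∈ K)) (θ : ℝ) :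
    infoSum (spinLaw V) (fun x => signVal (x u * x v))
      (fun (e : G.edgeSet) x => signVal (edgeSpin x e)) θ T (fun _ => 1) = 0 := by
  refine Finset.sum_eq_zero fun U _ => ?_
  rw [condSq]
  -- Flipping `K` preserves the spin law and the edge spins on `T` but reverses `x u * x v`; each
  -- numerator equals its own negative.
  have h := (measurePreserving_flipSpins K).integral_comp'
    (f := MeasurableEquiv.mk ⟨flipSpins K, flipSpins K, fun x => ?_, fun x => ?_⟩ (measurable_flipSpins K)
      (measurable_flipSpins K))
    (fun x => signVal (x u * x v) *
      (1 * ∏ e ∈ T, (1 + θ * (signOn (U : Set G.edgeSet) e * signVal (edgeSpin x e))) / 2))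
  · have e : ∀ x : V → ℤˣ, signVal (flipSpins K x u * flipSpins K x v) *
      (1 * ∏ e ∈ T, (1 + θ * (signOn (U : Set G.edgeSet) e *
        signVal (edgeSpin (flipSpins K x) e))) / 2) = -(signVal (x u * x v) *
      (1 * ∏ e ∈ T, (1 + θ * (signOn (U : Set G.edgeSet) e * signVal (edgeSpin x e))) / 2)) := by
      intro x
      have h1 : flipSpins K x u = -x u := if_pos hu
      have h2 : flipSpins K x v = x v := if_neg hv
      rw [h1, h2, neg_mul, signVal_neg, neg_mul]
      congr 3
      refine Finset.prod_congr rfl fun e he => ?_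
      obtain ⟨e, hG⟩ := e
      induction e with
      | h a b => rw [edgeSpin_flipSpins x (hT a b hG he)]
    simp only [MeasurableEquiv.coe_mk, Equiv.coe_fn_mk] at h
    rw [integral_congr_ae (ae_of_all _ e), integral_neg] at h
    have h0 := neg_eq_self.1 h
    rw [h0, zero_pow two_ne_zero, zero_div]
  all_goals
    ext w
    unfold flipSpins
    split_ifs <;> simp

end Flip

/-! ### From information on the square lattice to percolation. -/

section SquareLattice

/-- The doubled midpoint of an edge of the square lattice. -/
def doubledMidpoint : squareLattice.edgeSet ↪ ℤ × ℤ where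
  toFun e := Sym2.lift ⟨fun u v => u + v, fun u v => add_comm u v⟩ (e : Sym2 (ℤ × ℤ))
  inj' := by
    rintro ⟨e, he⟩ ⟨e', he'⟩ h
    induction e with
    | h u v =>
      induction e' with
      | h u' v' =>
        have h' : u + v = u' + v' := h
        rw [Subtype.mk.injEq, Sym2.eq_iff]
        exact eq_or_eq_of_add_eq he he' h'

/-- Two distant vertices share little information: finite set version. -/
theorem exists_infoSum_le {δ : ℝ} (hδ : 0 < δ) : ∃ M : ℤ, ∀ v : ℤ × ℤ, M ≤ supNorm v →
    ∀ t : ℝ, t ^ 2 ≤ 1 / 2 → ∀ F : Finset squareLattice.edgeSet,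
      infoSum (spinLaw (ℤ × ℤ)) (fun x => signVal (x 0 * x v))
        (fun (e : squareLattice.edgeSet) x => signVal (edgeSpin x e)) t F (fun _ => 1) ≤ δ := by
  classical
  obtain ⟨M, A, hA, hA', hAδ, hsep⟩ := exists_pr_not_separated_le hδ
  refine ⟨M, fun v hv t ht F => ?_⟩
  have hf : IsSign fun x : ℤ × ℤ → ℤˣ => signVal (x 0 * x v) :=
    isSign_signVal (measurable_edgeSpin s(0, v))
  have hs : ∀ e : squareLattice.edgeSet,
      IsSign fun x : ℤ × ℤ → ℤˣ => signVal (edgeSpin x e) :=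
    fun e => isSign_signVal (measurable_edgeSpin _)
  have hw : IsWeight fun _ : ℤ × ℤ → ℤˣ => (1 : ℝ) :=
    ⟨measurable_const, fun _ => zero_le_one, 1, fun _ => le_rfl⟩
  refine (infoSum_le_avg hf hs hw ht F).trans ?_
  refine le_trans ?_ ((prob_le_pr hA hA' (F.map doubledMidpoint)).trans hAδ)
  rw [prob, avg_map, avg]
  gcongr with T hT
  -- Without a blocking annulus the trivial bound 1 is used; otherwise the blocking set contains 0,
  -- not `v`, and no edge of `T` crosses its boundary.
  split_ifs with hAT
  · simpa using infoSum_le (μ := spinLaw (ℤ × ℤ)) hf hs hw (θ := 1) (by simp) T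
  · obtain ⟨K, hK0, hKM, hK⟩ := hsep _ hAT
    refine (infoSum_eq_zero_of_separated hK0 (fun h => ?_) (fun a b hG hab => ?_) 1).le
    · have := hKM v h
      omega
    · have ho : IsOpenEdge (doubledMidpoint '' T) a b := ⟨hG, ⟨s(a, b), hG⟩, hab, rfl⟩
      exact ⟨fun h => hK a h b ho, fun h => hK b h a ho.symm⟩

end SquareLattice

/-! ### Chi-squared information of a pair of uniform signs. -/

section ChiSquared

/-- If both marginals of a law on pairs of signs are uniform, then its chi-squared mutual
information is the square of its correlation. -/
lemma jointChiSqInfo_eq (ρ : Measure (ℤˣ × ℤˣ)) [IsProbabilityMeasure ρ]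
    (h₁ : ρ (Prod.fst ⁻¹' {1}) = ρ (Prod.fst ⁻¹' {-1}))
    (h₂ : ρ (Prod.snd ⁻¹' {1}) = ρ (Prod.snd ⁻¹' {-1})) :
    jointChiSqInfo ρ = ENNReal.ofReal ((∫ p, signVal (p.1 * p.2) ∂ρ) ^ 2) := by
  classical
  have meas : ∀ s : Set (ℤˣ × ℤˣ), MeasurableSet s := fun s => .of_discrete
  have huniv : (Finset.univ : Finset ℤˣ) = {1, -1} := by decide
  have cover : ∀ f : ℤˣ × ℤˣ → ℤˣ, ρ.real (f ⁻¹' {1}) + ρ.real (f ⁻¹' {-1}) = 1 := by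
    intro f
    have hd : Disjoint (f ⁻¹' {1}) (f ⁻¹' {-1}) :=
      Disjoint.preimage f (by simp)
    rw [← measureReal_union hd (meas _), ← Set.preimage_union]
    have : ({1} ∪ {-1} : Set ℤˣ) = Set.univ := by
      ext a
      rcases Int.units_eq_one_or a with rfl | rfl <;> simp
    rw [this, Set.preimage_univ, probReal_univ]
  have half₁ : ∀ a, ρ.real (Prod.fst ⁻¹' {a}) = 1 / 2 := by
    have e : ρ.real (Prod.fst ⁻¹' {1}) = ρ.real (Prod.fst ⁻¹' {-1}) := by rw [Measure.real, h₁]; rfl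
    have := cover Prod.fst
    intro a
    rcases Int.units_eq_one_or a with rfl | rfl <;> linarith
  have half₂ : ∀ a, ρ.real (Prod.snd ⁻¹' {a}) = 1 / 2 := by
    have e : ρ.real (Prod.snd ⁻¹' {1}) = ρ.real (Prod.snd ⁻¹' {-1}) := by rw [Measure.real, h₂]; rfl
    have := cover Prod.snd
    intro a
    rcases Int.units_eq_one_or a with rfl | rfl <;> linarith
  have hq : ∀ p : ℤˣ × ℤˣ, (ρ.fst.prod ρ.snd).real {p} = 1 / 4 := by
    rintro ⟨a, b⟩
    rw [← Set.singleton_prod_singleton, measureReal_def, Measure.prod_prod, ENNReal.toReal_mul,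
      Measure.fst_apply .of_discrete, Measure.snd_apply .of_discrete]
    have e1 := half₁ a
    have e2 := half₂ b
    rw [measureReal_def] at e1 e2
    rw [e1, e2]
    norm_num
  have hac : ρ ≪ ρ.fst.prod ρ.snd := by
    intro s hs
    have : s = ∅ := by
      by_contra hne
      obtain ⟨p, hp⟩ := Set.nonempty_iff_ne_empty.2 hne
      have h0 : (ρ.fst.prod ρ.snd).real {p} = 0 := by
        rw [measureReal_def, measure_mono_null (Set.singleton_subset_iff.2 hp) hs,
          ENNReal.toReal_zero]
      rw [hq] at h0
      norm_num at h0
    rw [this, measure_empty]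
  -- The product of the marginals gives mass 1/4 to each of the four points.
  have hrn : ∀ p, (ρ.rnDeriv (ρ.fst.prod ρ.snd) p).toReal = 4 * ρ.real {p} := by
    intro p
    have := Measure.haveLebesgueDecomposition_of_sigmaFinite ρ (ρ.fst.prod ρ.snd)
    have h := Measure.setLIntegral_rnDeriv hac {p}
    rw [lintegral_singleton] at h
    have h' := congrArg ENNReal.toReal h
    rw [ENNReal.toReal_mul, ← measureReal_def, ← measureReal_def, hq] at h'
    linarith
  have s1 : ∀ a, ρ.real {(a, 1)} + ρ.real {(a, -1)} = 1 / 2 := by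
    intro a
    rw [← half₁ a, ← measureReal_union (by simp) (meas _)]
    congr 1
    ext ⟨x, y⟩
    rcases Int.units_eq_one_or y with rfl | rfl <;> simp
  have s2 : ∀ b, ρ.real {(1, b)} + ρ.real {(-1, b)} = 1 / 2 := by
    intro b
    rw [← half₂ b, ← measureReal_union (by simp) (meas _)]
    congr 1
    ext ⟨x, y⟩
    rcases Int.units_eq_one_or x with rfl | rfl <;> simp
  rw [jointChiSqInfo, chiSqDiv, if_pos hac, lintegral_fintype]
  have hterm : ∀ p : ℤˣ × ℤˣ, ENNReal.ofReal (((ρ.rnDeriv (ρ.fst.prod ρ.snd) p).toReal - 1) ^ 2) *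
      (ρ.fst.prod ρ.snd) {p} = ENNReal.ofReal ((4 * ρ.real {p} - 1) ^ 2 * (1 / 4)) := by
    intro p
    rw [hrn, ENNReal.ofReal_mul (sq_nonneg _), ← hq p, ofReal_measureReal]
  rw [Finset.sum_congr rfl fun p _ => hterm p, ← ENNReal.ofReal_sum_of_nonneg
    fun p _ => by positivity, integral_fintype (.of_finite)]
  congr 1
  simp only [Fintype.sum_prod_type, huniv, Finset.sum_pair (show (1 : ℤˣ) ≠ -1 by decide),
    smul_eq_mul, signVal]
  have a1 := s1 1
  have a2 := s1 (-1)
  have b1 := s2 1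
  -- Uniform marginals leave the mass of `(1, 1)` as the only parameter.
  have e1 : ρ.real {(1, -1)} = 1 / 2 - ρ.real {(1, 1)} := by linarith
  have e2 : ρ.real {(-1, 1)} = 1 / 2 - ρ.real {(1, 1)} := by linarith
  have e3 : ρ.real {(-1, -1)} = ρ.real {(1, 1)} := by linarith
  rw [e1, e2, e3]
  push_cast
  norm_num
  ring

end ChiSquared

/-! ### The joint law of spins and observations. -/

section Conditioning

variable {V : Type*} {G : SimpleGraph V} {ε : unitInterval}

/-- The joint law of the spins and the observations. -/
noncomputable def syncLaw (G : SimpleGraph V) (ε : unitInterval) :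
    Measure ((V → ℤˣ) × (G.edgeSet → ℤˣ)) :=
  spinLaw V ⊗ₘ graphicalChannel G (fun _ => bsc ε)

instance : IsProbabilityMeasure (syncLaw G ε) := by
  unfold syncLaw
  infer_instance

lemma bsc_real_singleton (a b : ℤˣ) :
    (bsc ε a).real {b} = (1 + (1 - 2 * (ε : ℝ)) * (signVal b * signVal a)) / 2 := by
  have e : bsc ε a = ENNReal.ofReal (1 - ε) • Measure.dirac a +
    ENNReal.ofReal ε • Measure.dirac (-a) := rfl
  rw [e, measureReal_def, Measure.add_apply, Measure.smul_apply, Measure.smul_apply,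
    Measure.dirac_apply, Measure.dirac_apply]
  have h1 : (0 : ℝ) ≤ 1 - ε := sub_nonneg.2 ε.2.2
  have h2 : (0 : ℝ) ≤ ε := ε.2.1
  rcases Int.units_eq_one_or a with rfl | rfl <;> rcases Int.units_eq_one_or b with rfl | rfl <;>
    simp [signVal, h1, h2] <;> ring

/-- The observations on `F` are `-1` exactly on `U`. -/
def cell (F : Finset G.edgeSet) (U : Finset G.edgeSet) : Set (G.edgeSet → ℤˣ) :=
  {y | ∀ e ∈ F, y e = -1 ↔ e ∈ U}

lemma cell_eq_pi (F U : Finset G.edgeSet) : cell F U = (F : Set G.edgeSet).pi fun e =>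
    open Classical in {if e ∈ U then (-1 : ℤˣ) else 1} := by
  classical
  ext y
  simp only [cell, Set.mem_ofPred_eq, Set.mem_pi, Finset.mem_coe, Set.mem_singleton_iff]
  refine forall₂_congr fun e _ => ?_
  by_cases h : e ∈ U <;> rcases Int.units_eq_one_or (y e) with h' | h' <;> simp [h, h']

lemma measurableSet_cell (F U : Finset G.edgeSet) : MeasurableSet (cell F U) := by
  rw [cell_eq_pi]
  exact MeasurableSet.pi F.countable_toSet fun _ _ => .of_discrete

lemma channel_real_cell (x : V → ℤˣ) (F U : Finset G.edgeSet) :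
    (graphicalChannel G (fun _ => bsc ε) x).real (cell F U) =
      ∏ e ∈ F, (1 + (1 - 2 * (ε : ℝ)) *
        (signOn (U : Set G.edgeSet) e * signVal (edgeSpin x e))) / 2 := by
  classical
  have e : graphicalChannel G (fun _ => bsc ε) x =
    Measure.infinitePi fun e : G.edgeSet => bsc ε (edgeSpin x e) := rfl
  rw [e, cell_eq_pi, measureReal_def, Measure.infinitePi_pi _ fun _ _ => .of_discrete,
    ENNReal.toReal_prod]
  refine Finset.prod_congr rfl fun e _ => ?_
  rw [← measureReal_def, bsc_real_singleton]
  congr 4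
  unfold signOn
  by_cases h : e ∈ U <;> simp [h, signVal]

lemma channel_neg (x : V → ℤˣ) : graphicalChannel G (fun _ => bsc ε) (flipSpins Set.univ x) =
    graphicalChannel G (fun _ => bsc ε) x := by
  change Measure.infinitePi (fun e : G.edgeSet => bsc ε (edgeSpin (flipSpins Set.univ x) e)) =
    Measure.infinitePi fun e : G.edgeSet => bsc ε (edgeSpin x e)
  congr 1
  ext1 e
  obtain ⟨e, he⟩ := e
  induction e with
  | h a b => rw [edgeSpin_flipSpins x (by simp)]

/-- A spin is uniform and independent of the observations. -/
lemma syncLaw_spin_symm (u : V) {B : Set (G.edgeSet → ℤˣ)} (hB : MeasurableSet B) :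
    syncLaw G ε {p | p.2 ∈ B ∧ p.1 u = 1} = syncLaw G ε {p | p.2 ∈ B ∧ p.1 u = -1} := by
  have hm : ∀ a : ℤˣ, MeasurableSet {p : (V → ℤˣ) × (G.edgeSet → ℤˣ) | p.2 ∈ B ∧ p.1 u = a} :=
    fun a => (measurable_snd hB).inter (measurableSet_eq_fun
      ((measurable_pi_apply u).comp measurable_fst) measurable_const)
  have hl : ∀ a : ℤˣ, syncLaw G ε {p | p.2 ∈ B ∧ p.1 u = a} =
      ∫⁻ x, ({x | x u = a} : Set (V → ℤˣ)).indicator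
        (fun x => graphicalChannel G (fun _ => bsc ε) x B) x ∂spinLaw V := by
    intro a
    rw [syncLaw, Measure.compProd_apply (hm a)]
    refine lintegral_congr fun x => ?_
    by_cases hx : x u = a
    · rw [Set.indicator_of_mem (show x ∈ {x : V → ℤˣ | x u = a} from hx)]
      congr 1
      ext y
      simp [hx]
    · rw [Set.indicator_of_notMem (show x ∉ {x : V → ℤˣ | x u = a} from hx)]
      convert measure_empty (μ := graphicalChannel G (fun _ => bsc ε) x)
      ext y
      simp [hx]
  -- The global flip exchanges the two values of the spin while preserving the spin law and the
  -- channel output.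
  rw [hl, hl, ← (measurePreserving_flipSpins (Set.univ : Set V)).lintegral_comp]
  · refine lintegral_congr fun x => ?_
    have h1 : flipSpins Set.univ x u = -x u := if_pos trivial
    by_cases hx : x u = -1
    · rw [Set.indicator_of_mem (show x ∈ {x : V → ℤˣ | x u = -1} from hx),
        Set.indicator_of_mem (show _ ∈ {x : V → ℤˣ | x u = 1} by
          change flipSpins Set.univ x u = 1
          rw [h1, hx, neg_neg]), channel_neg]
    · rw [Set.indicator_of_notMem (show x ∉ {x : V → ℤˣ | x u = -1} from hx),
        Set.indicator_of_notMem (show _ ∉ {x : V → ℤˣ | x u = 1} by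
          change ¬ flipSpins Set.univ x u = 1
          rw [h1, neg_eq_iff_eq_neg]
          exact hx)]
  · exact (Kernel.measurable_coe _ hB).indicator ((measurable_pi_apply u) (.of_discrete (s := {1})))

variable {Ω : Type*} [MeasurableSpace Ω] {P : Measure Ω} [IsProbabilityMeasure P]
  {X : Ω → V → ℤˣ} {Y : Ω → G.edgeSet → ℤˣ}

/-- This identity is all that is used later about the conditional law: the following lemmas assume
it for an abstract pair `ν`, `κ`. -/
lemma compProd_condDistrib (hXY : IsSyncInstance P G (fun _ => bsc ε) X Y) (u v : V) :
    P.map Y ⊗ₘ condDistrib (fun ω => (X ω u, X ω v)) Y P =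
      (syncLaw G ε).map fun p => (p.2, (p.1 u, p.1 v)) := by
  have hm : Measurable fun p : (V → ℤˣ) × (G.edgeSet → ℤˣ) => (p.2, (p.1 u, p.1 v)) :=
    measurable_snd.prodMk (((measurable_pi_apply u).comp measurable_fst).prodMk
      ((measurable_pi_apply v).comp measurable_fst))
  have hA : AEMeasurable (fun ω => (X ω, Y ω)) P := hXY.aemeasurable
  have h2 : AEMeasurable (fun ω => (X ω u, X ω v)) P :=
    (measurable_snd.comp hm).comp_aemeasurable hA
  rw [compProd_map_condDistrib h2, syncLaw, ← hXY.map_eq, AEMeasurable.map_map_of_aemeasurable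
    hm.aemeasurable hA]
  rfl

end Conditioning

/-! ### From finitely many observations to all of them. -/

section Convergence

variable {V : Type*} {G : SimpleGraph V} {ε : unitInterval} {u v : V}
  {ν : Measure (G.edgeSet → ℤˣ)} [IsProbabilityMeasure ν]
  {κ : Kernel (G.edgeSet → ℤˣ) (ℤˣ × ℤˣ)} [IsMarkovKernel κ]

lemma ae_marginal_symm (hκ : ν ⊗ₘ κ = (syncLaw G ε).map fun p => (p.2, (p.1 u, p.1 v)))
    (f : ℤˣ × ℤˣ → ℤˣ) (w : V) (hw : ∀ x : V → ℤˣ, f (x u, x v) = x w) :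
    ∀ᵐ y ∂ν, κ y (f ⁻¹' {1}) = κ y (f ⁻¹' {-1}) := by
  have hm : Measurable fun p : (V → ℤˣ) × (G.edgeSet → ℤˣ) => (p.2, (p.1 u, p.1 v)) :=
    measurable_snd.prodMk (((measurable_pi_apply u).comp measurable_fst).prodMk
      ((measurable_pi_apply v).comp measurable_fst))
  have key : ∀ B, MeasurableSet B → ∀ a, ∫⁻ y in B, κ y (f ⁻¹' {a}) ∂ν =
      syncLaw G ε {p | p.2 ∈ B ∧ p.1 w = a} := by
    intro B hB a
    have hS : MeasurableSet (f ⁻¹' {a}) := .of_discrete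
    rw [← Measure.compProd_apply_prod hB hS, hκ, Measure.map_apply hm (hB.prod hS)]
    congr 1
    ext p
    simp [hw]
  refine ae_eq_of_forall_setLIntegral_eq_of_sigmaFinite (Kernel.measurable_coe κ .of_discrete)
    (Kernel.measurable_coe κ .of_discrete) fun B hB _ => ?_
  rw [key B hB, key B hB, syncLaw_spin_symm w hB]

lemma setIntegral_kernel (hκ : ν ⊗ₘ κ = (syncLaw G ε).map fun p => (p.2, (p.1 u, p.1 v)))
    (f : ℤˣ × ℤˣ → ℝ) {B : Set (G.edgeSet → ℤˣ)} (hB : MeasurableSet B) :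
    ∫ y in B, ∫ p, f p ∂κ y ∂ν =
      ∫ x, f (x u, x v) * (graphicalChannel G (fun _ => bsc ε) x).real B ∂spinLaw V := by
  have hm : Measurable fun p : (V → ℤˣ) × (G.edgeSet → ℤˣ) => (p.2, (p.1 u, p.1 v)) :=
    measurable_snd.prodMk (((measurable_pi_apply u).comp measurable_fst).prodMk
      ((measurable_pi_apply v).comp measurable_fst))
  have hf : Measurable f := .of_discrete
  obtain ⟨C, hC⟩ : ∃ C, ∀ p, ‖f p‖ ≤ C := by
    obtain ⟨C, hC⟩ := (Set.finite_range fun p => ‖f p‖).bddAbove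
    exact ⟨C, fun p => hC ⟨p, rfl⟩⟩
  have i1 : Integrable (fun z : (G.edgeSet → ℤˣ) × (ℤˣ × ℤˣ) => f z.2) (ν ⊗ₘ κ) :=
    .of_bound (hf.comp measurable_snd).aestronglyMeasurable C (ae_of_all _ fun z => hC _)
  have i2 : Integrable (fun p : (V → ℤˣ) × (G.edgeSet → ℤˣ) => f (p.1 u, p.1 v))
      (syncLaw G ε) :=
    .of_bound (hf.comp (measurable_snd.comp hm)).aestronglyMeasurable C
      (ae_of_all _ fun z => hC _)
  have e1 := Measure.setIntegral_compProd (μ := ν) (κ := κ) hB MeasurableSet.univ i1.integrableOn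
  have e2 := Measure.setIntegral_compProd (μ := spinLaw V)
    (κ := graphicalChannel G fun _ => bsc ε) MeasurableSet.univ hB i2.integrableOn
  simp only [Measure.restrict_univ, integral_const, MeasurableSet.univ, measureReal_restrict_apply,
    Set.univ_inter, smul_eq_mul] at e1 e2
  have hfm : AEStronglyMeasurable (fun z : (G.edgeSet → ℤˣ) × (ℤˣ × ℤˣ) => f z.2)
      ((syncLaw G ε).map fun p => (p.2, (p.1 u, p.1 v))) :=
    (hf.comp measurable_snd).aestronglyMeasurable
  rw [← e1, hκ, setIntegral_map (hB.prod MeasurableSet.univ) hfm hm.aemeasurable]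
  refine Eq.trans ?_ (e2.trans (integral_congr_ae (ae_of_all _ fun x => mul_comm _ _)))
  congr 2
  ext p
  simp

/-- The conditional correlation of two spins given the observations. -/
noncomputable def correlation (κ : Kernel (G.edgeSet → ℤˣ) (ℤˣ × ℤˣ)) (y : G.edgeSet → ℤˣ) : ℝ :=
  ∫ p, signVal (p.1 * p.2) ∂κ y

lemma stronglyMeasurable_correlation : StronglyMeasurable (correlation κ) := by
  have : StronglyMeasurable fun p : ℤˣ × ℤˣ => signVal (p.1 * p.2) :=
    (Measurable.of_discrete).stronglyMeasurable
  exact (this.comp_measurable measurable_snd).integral_kernel_prod_right'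

lemma abs_correlation_le (y : G.edgeSet → ℤˣ) : |correlation κ y| ≤ 1 := by
  have h := norm_integral_le_of_norm_le_const (μ := κ y) (f := fun p => signVal (p.1 * p.2))
    (C := 1) (ae_of_all _ fun p => by rcases signVal_eq (p.1 * p.2) with h | h <;> simp [h])
  simpa [correlation] using h

lemma integrable_correlation : Integrable (correlation κ) ν :=
  .of_bound stronglyMeasurable_correlation.aestronglyMeasurable 1
    (ae_of_all _ abs_correlation_le)

/-- A dual characterization of the information carried by finitely many observations. -/
lemma integral_le_infoSum (hκ : ν ⊗ₘ κ = (syncLaw G ε).map fun p => (p.2, (p.1 u, p.1 v)))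
    (F : Finset G.edgeSet) (g : (G.edgeSet → ℤˣ) → ℝ)
    (hg : ∀ y y', (∀ e ∈ F, y e = y' e) → g y = g y') :
    ∫ y, (2 * correlation κ y * g y - g y ^ 2) ∂ν ≤
      infoSum (spinLaw V) (fun x => signVal (x u * x v))
        (fun (e : G.edgeSet) x => signVal (edgeSpin x e)) (1 - 2 * ε) F (fun _ => 1) := by
  classical
  set y₀ : Finset G.edgeSet → G.edgeSet → ℤˣ := fun U e => if e ∈ U then -1 else 1 with hy₀
  have hcell : ∀ U, ∀ y ∈ cell F U, g y = g (y₀ U) := by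
    intro U y hy
    refine hg _ _ fun e he => ?_
    have := hy e he
    by_cases h : e ∈ U
    · simp [hy₀, h, this.2 h]
    · rcases Int.units_eq_one_or (y e) with h' | h'
      · simp [hy₀, h, h']
      · exact absurd (this.1 h') h
  -- Exactly one cell contains `y`, the one indexed by the edges of `F` where `y` is `-1`.
  have hsum : ∀ y, 2 * correlation κ y * g y - g y ^ 2 = ∑ U ∈ F.powerset,
      (cell F U).indicator (fun y => 2 * g (y₀ U) * correlation κ y - g (y₀ U) ^ 2) y := by
    intro y
    have hmem : y ∈ cell F (F.filter fun e => y e = -1) := by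
      intro e he
      simp [he]
    rw [Finset.sum_eq_single (F.filter fun e => y e = -1)]
    · rw [Set.indicator_of_mem hmem, ← hcell _ y hmem]
      ring
    · intro U hU hne
      refine Set.indicator_of_notMem (fun hy => hne ?_) _
      ext e
      rw [Finset.mem_filter]
      exact ⟨fun h => ⟨Finset.mem_powerset.1 hU h, (hy e (Finset.mem_powerset.1 hU h)).2 h⟩,
        fun h => (hy e h.1).1 h.2⟩
    · intro h
      exact absurd (Finset.mem_powerset.2 (Finset.filter_subset _ _)) h
  have hint : ∀ U : Finset G.edgeSet,
      Integrable (fun y => 2 * g (y₀ U) * correlation κ y - g (y₀ U) ^ 2) ν :=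
    fun U => (integrable_correlation.const_mul _).sub (integrable_const _)
  simp only [hsum]
  rw [integral_finsetSum _ fun U _ => (hint U).indicator (measurableSet_cell F U), infoSum]
  refine Finset.sum_le_sum fun U _ => ?_
  set W : (V → ℤˣ) → ℝ := fun x => 1 * ∏ e ∈ F, (1 + (1 - 2 * (ε : ℝ)) *
    (signOn (U : Set G.edgeSet) e * signVal (edgeSpin x e))) / 2 with hW
  have hWc : ∀ x, (graphicalChannel G (fun _ => bsc ε) x).real (cell F U) = W x := fun x => by
    rw [channel_real_cell]
    exact (one_mul _).symm
  have e1 := setIntegral_kernel hκ (fun p => signVal (p.1 * p.2)) (measurableSet_cell F U)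
  have e2 := setIntegral_kernel hκ (fun _ => 1) (measurableSet_cell F U)
  simp only [integral_const, probReal_univ, smul_eq_mul, mul_one, one_mul, hWc,
    measureReal_restrict_apply MeasurableSet.univ, Set.univ_inter] at e1 e2
  have ha : |1 - 2 * (ε : ℝ)| ≤ 1 := by
    have h1 := ε.2.1
    have h2 := ε.2.2
    rw [abs_le]
    constructor <;> linarith
  have hwt : IsWeight W := IsWeight.mul_prod
    ⟨measurable_const, fun _ => zero_le_one, 1, fun _ => le_rfl⟩
    (fun e => isSign_signVal (measurable_edgeSpin _)) ha F U
  have hle := abs_integral_mul_le (μ := spinLaw V)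
    (isSign_signVal (measurable_edgeSpin s(u, v))) hwt
  change |∫ x, signVal (x u * x v) * W x ∂spinLaw V| ≤ _ at hle
  rw [integral_indicator (measurableSet_cell F U), integral_sub
    (integrable_correlation.const_mul _).integrableOn (integrable_const _), integral_const_mul,
    integral_const, measureReal_restrict_apply MeasurableSet.univ, Set.univ_inter, smul_eq_mul, e2]
  change 2 * g (y₀ U) * ∫ y in cell F U, ∫ p, signVal (p.1 * p.2) ∂κ y ∂ν - _ ≤ _
  rw [e1, condSq]
  set N := ∫ x, signVal (x u * x v) * W x ∂spinLaw V
  set Z := ∫ x, W x ∂spinLaw V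
  have hZ : 0 ≤ Z := (abs_nonneg _).trans hle
  rcases hZ.eq_or_lt with hZ | hZ
  · rw [← hZ, abs_nonpos_iff] at hle
    rw [hle, ← hZ]
    simp
  · rw [le_div_iff₀ hZ]
    -- On a cell of mass `Z`, `2gN - g²Z ≤ N² / Z` by completing the square.
    nlinarith [sq_nonneg (N - g (y₀ U) * Z)]

/-- The sigma-algebras generated by finitely many observations. -/
def observationFiltration {E : Type*} (q : ℕ → Finset E) (hq : Monotone q) :
    Filtration ℕ (inferInstance : MeasurableSpace (E → ℤˣ)) where
  seq n := MeasurableSpace.comap ((q n).restrict (π := fun _ => ℤˣ)) MeasurableSpace.pi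
  mono' n m h := by
    have : (q n).restrict (π := fun _ => ℤˣ) =
        Finset.restrict₂ (π := fun _ : E => ℤˣ) (hq h) ∘ (q m).restrict := rfl
    beta_reduce
    rw [this, ← MeasurableSpace.comap_comp]
    exact MeasurableSpace.comap_mono (Finset.measurable_restrict₂ _).comap_le
  le' n := (Finset.measurable_restrict (q n)).comap_le

lemma iSup_observationFiltration {E : Type*} (q : ℕ → Finset E) (hq : Monotone q)
    (hq' : ∀ e, ∃ n, e ∈ q n) :
    ⨆ n, (observationFiltration q hq n : MeasurableSpace (E → ℤˣ)) = MeasurableSpace.pi := by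
  refine le_antisymm (iSup_le fun n => (observationFiltration q hq).le n) ?_
  refine iSup_le fun e => ?_
  obtain ⟨n, hn⟩ := hq' e
  refine le_trans ?_ (le_iSup _ n)
  have : (fun y : E → ℤˣ => y e) = (fun z : q n → ℤˣ => z ⟨e, hn⟩) ∘ (q n).restrict := rfl
  rw [this, ← MeasurableSpace.comap_comp]
  exact MeasurableSpace.comap_mono (measurable_pi_apply _).comap_le

/-- In `integral_le_infoSum` the test function is the conditional expectation of the correlation
given the first observations. By Lévy's upward theorem it converges to the correlation, and the left
side tends to the second moment. -/
lemma integral_correlation_sq_le [Countable G.edgeSet] [Nonempty G.edgeSet]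
    (hκ : ν ⊗ₘ κ = (syncLaw G ε).map fun p => (p.2, (p.1 u, p.1 v))) {δ : ℝ}
    (hδ : ∀ F : Finset G.edgeSet, infoSum (spinLaw V) (fun x => signVal (x u * x v))
        (fun (e : G.edgeSet) x => signVal (edgeSpin x e)) (1 - 2 * ε) F (fun _ => 1) ≤ δ) :
    ∫ y, correlation κ y ^ 2 ∂ν ≤ δ := by
  classical
  obtain ⟨enum, henum⟩ := exists_surjective_nat G.edgeSet
  set q : ℕ → Finset G.edgeSet := fun n => (Finset.range n).image enum with hqdef
  have hq : Monotone q := fun n m h => Finset.image_subset_image (Finset.range_mono h)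
  have hq' : ∀ e, ∃ n, e ∈ q n := fun e => by
    obtain ⟨k, rfl⟩ := henum e
    exact ⟨k + 1, Finset.mem_image_of_mem _ (Finset.self_mem_range_succ k)⟩
  set ℱ := observationFiltration q hq
  have hr : StronglyMeasurable[⨆ n, ℱ n] (correlation κ) := by
    rw [iSup_observationFiltration q hq hq']
    exact stronglyMeasurable_correlation
  have hlim := integrable_correlation.tendsto_ae_condExp (μ := ν) (ℱ := ℱ) hr
  set g : ℕ → (G.edgeSet → ℤˣ) → ℝ := fun n => ν[correlation κ | ℱ n] with hgdef
  have hb : ∀ n, ∀ᵐ y ∂ν, |g n y| ≤ 1 := fun n =>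
    ae_bdd_abs_condExp_of_ae_bdd_abs (ae_of_all _ abs_correlation_le)
  have hgm : ∀ n, AEStronglyMeasurable (g n) ν := fun n =>
    (stronglyMeasurable_condExp.mono (ℱ.le n)).aestronglyMeasurable
  have hle : ∀ n, ∫ y, (2 * correlation κ y * g n y - g n y ^ 2) ∂ν ≤ δ := by
    intro n
    refine (integral_le_infoSum hκ (q n) (g n) ?_).trans (hδ (q n))
    intro y y' hyy
    have hs : StronglyMeasurable[ℱ n] (g n) := stronglyMeasurable_condExp
    obtain ⟨h, -, hh⟩ := hs.exists_eq_measurable_comp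
    rw [hh]
    have : (q n).restrict y = (q n).restrict y' := by
      ext e
      rw [Finset.restrict, Finset.restrict, hyy e e.2]
    simp only [Function.comp, this]
  have hconv : Tendsto (fun n => ∫ y, (2 * correlation κ y * g n y - g n y ^ 2) ∂ν) atTop
      (𝓝 (∫ y, correlation κ y ^ 2 ∂ν)) := by
    -- Both functions are bounded by 1, whence the bound 3 = 2 + 1.
    refine tendsto_integral_of_dominated_convergence (fun _ => 3) (fun n => ?_)
      (integrable_const _) (fun n => ?_) ?_
    · exact ((stronglyMeasurable_correlation.aestronglyMeasurable.const_mul 2).mul (hgm n)).sub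
        ((hgm n).pow 2)
    · filter_upwards [hb n] with y hy
      have h1 := abs_correlation_le (κ := κ) y
      rw [Real.norm_eq_abs, abs_le]
      rw [abs_le] at hy h1
      constructor <;> nlinarith
    · filter_upwards [hlim] with y hy
      have := ((hy.const_mul (2 * correlation κ y)).sub (hy.pow 2))
      convert this using 2
      ring
  exact le_of_tendsto' hconv hle

/-- The conditional chi-squared information of two spins is bounded by the information carried by
finitely many observations. -/
theorem condChiSqInfo_le [Countable G.edgeSet] [Nonempty G.edgeSet] {Ω : Type*}
    [MeasurableSpace Ω] {P : Measure Ω} [IsProbabilityMeasure P] {X : Ω → V → ℤˣ}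
    {Y : Ω → G.edgeSet → ℤˣ} (hXY : IsSyncInstance P G (fun _ => bsc ε) X Y) {δ : ℝ}
    (hδ : ∀ F : Finset G.edgeSet, infoSum (spinLaw V) (fun x => signVal (x u * x v))
        (fun (e : G.edgeSet) x => signVal (edgeSpin x e)) (1 - 2 * ε) F (fun _ => 1) ≤ δ) :
    condChiSqInfo (fun ω => X ω u) (fun ω => X ω v) Y P ≤ ENNReal.ofReal δ := by
  have hκ := compProd_condDistrib hXY u v
  have hY : AEMeasurable Y P :=
    measurable_snd.comp_aemeasurable (show AEMeasurable (fun ω => (X ω, Y ω)) P from hXY.aemeasurable)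
  have : IsProbabilityMeasure (P.map Y) := Measure.isProbabilityMeasure_map hY
  have h1 := ae_marginal_symm hκ Prod.fst u fun _ => rfl
  have h2 := ae_marginal_symm hκ Prod.snd v fun _ => rfl
  have h3 := integral_correlation_sq_le hκ hδ
  have hi : Integrable (fun y => correlation
      (condDistrib (fun ω => (X ω u, X ω v)) Y P) y ^ 2) (P.map Y) :=
    .of_bound (stronglyMeasurable_correlation.pow 2).aestronglyMeasurable 1
      (ae_of_all _ fun y => by
        rw [norm_pow]
        exact pow_le_one₀ (norm_nonneg _) (abs_correlation_le y))
  rw [condChiSqInfo, lintegral_congr_ae (g := fun y => ENNReal.ofReal (correlation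
    (condDistrib (fun ω => (X ω u, X ω v)) Y P) y ^ 2))]
  · rw [← ofReal_integral_eq_lintegral_ofReal hi (ae_of_all _ fun y => sq_nonneg _)]
    exact ENNReal.ofReal_le_ofReal h3
  · filter_upwards [h1, h2] with y hy1 hy2
    exact jointChiSqInfo_eq _ hy1 hy2

end Convergence

end GridSync

open GridSync in
theorem mainTheorem7 {Ω : Type*} [MeasurableSpace Ω] (P : Measure Ω) [IsProbabilityMeasure P]
    (ε : unitInterval) (hε : (1 - 2 * (ε : ℝ)) ^ 2 ≤ 1 / 2)
    (X : Ω → ℤ × ℤ → ℤˣ) (Y : Ω → squareLattice.edgeSet → ℤˣ)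
    (hXY : IsSyncInstance P squareLattice (fun _ => bsc ε) X Y)
    (v : ℕ → ℤ × ℤ) (hv : ∀ k, 1 ≤ k → squareLattice.dist 0 (v k) = k) :
    Tendsto (fun k => condChiSqInfo (fun ω => X ω 0) (fun ω => X ω (v k)) Y P) atTop (𝓝 0) := by
  have : Nonempty squareLattice.edgeSet :=
    ⟨⟨s((0, 0), (1, 0)), by simp [squareLattice_adj]⟩⟩
  have hc : Countable squareLattice.edgeSet := doubledMidpoint.injective.countable
  rw [ENNReal.tendsto_nhds_zero]
  intro η hη
  obtain ⟨δ, hδ, hδη⟩ : ∃ δ : ℝ, 0 < δ ∧ ENNReal.ofReal δ ≤ η := by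
    rcases eq_or_ne η ∞ with rfl | hη'
    · exact ⟨1, one_pos, le_top⟩
    · exact ⟨η.toReal, ENNReal.toReal_pos hη.ne' hη', ENNReal.ofReal_toReal_le⟩
  obtain ⟨M, hM⟩ := exists_infoSum_le hδ
  -- The ball of radius `M` is finite, so graph distances from 0 are bounded on it; vertices at
  -- larger distance lie outside.
  obtain ⟨n, hn⟩ := ((finite_annulus 0 M).image fun z => squareLattice.dist 0 z).bddAbove
  filter_upwards [eventually_ge_atTop (n + 1)] with k hk
  refine (condChiSqInfo_le hXY (hM (v k) ?_ _ hε)).trans hδη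
  by_contra hlt
  have h0 : 0 ≤ supNorm (v k) := by rw [supNorm]; omega
  have h1 := hn ⟨v k, ⟨h0, (not_le.1 hlt).le⟩, rfl⟩
  simp only [hv k (by omega)] at h1
  omega
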